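/- Let $\mathbb G=(\mathbb R^n,\cdot)$, $n\ge 1$, be a Carnot group, i.e. a connected, simply connected, nilpotent Lie group whose Lie algebra is stratified, $\mathfrak g=V_1\oplus\dots\oplus V_k$ with $[V_1,V_i]=V_{i+1}$, $V_k\ne\{0\}$ and $V_i=\{0\}$ for $i>k$, written in exponential coordinates with respect to a basis adapted to the stratification, whose $j$-th vector lies in $V_{d_j}$ with $1\le d_1\le\dots\le d_n$. It is endowed with the Lebesgue measure and with the group automorphisms $\delta_\lambda(x_1,\dots,x_n)=(\lambda^{d_1}x_1,\dots,\lambda^{d_n}x_n)$, $\lambda>0$. Let $Q=\sum_i i\dim V_i=\sum_j d_j$. Let $\|\cdot\|_{\mathbb G}:\mathbb G\to[0,\infty)$ be a homogeneous norm: it is continuous, $\|x\|_{\mathbb G}=0$ if and only if $x=0$, $\|x^{-1}\|_{\mathbb G}=\|x\|_{\mathbb G}$, and $\|\delta_\lambda x\|_{\mathbb G}=\lambda\|x\|_{\mathbb G}$ for all $\lambda>0$. Suppose that it satisfies the triangle inequality $\big|\|y\|_{\mathbb G}-\|x\|_{\mathbb G}\big|\le\|y^{-1}\cdot x\|_{\mathbb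 G}\le\|x\|_{\mathbb G}+\|y\|_{\mathbb G}$. Let $C_b$ be the Lebesgue measure of the unit ball $\{\|x\|_{\mathbb G}<1\}$. Let $\varphi(t)=\int_0^t\phi(\tau)\,d\tau$, $t\ge 0$, be an Orlicz function: $\phi:[0,\infty)\to[0,\infty)$ is nondecreasing and right-continuous, $\phi(0)=0$, $\phi(t)>0$ for $t>0$, and $\phi(t)\to\infty$ as $t\to\infty$. Suppose that, for constants $1<p^-\le p^+<\infty$, $$p^-\le\frac{t\,\phi(t)}{\varphi(t)}\le p^+\qquad\text{for all }t>0.$$ For measurable $u:\mathbb G\to\mathbb R$ and $0<s<1$ put $$\Phi_\varphi(u)=\int_{\mathbb G}\varphi(|u(x)|)\,dx,\qquad \Phi_{s,\varphi}(u)=\iint_{\mathbb G\times\mathbb G}\varphi\left(\frac{|u(x)-u(y)|}{\|y^{-1}\cdot x\|_{\mathbb G}^s}\right)\frac{dx\,dy}{\|y^{-1}\cdot x\|_{\mathbb G}^Q},$$ $$L^\varphi(\mathbb G)=\{u \text{ measurable}:\Phi_\varphi(u)<\infty\},\qquad W^{s,\varphi}(\mathbb G)=\{u\in L^\varphi(\mathbb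 G):\Phi_{s,\varphi}(u)<\infty\}.$$ Assume that $\varphi$ satisfies the Minkowski-type inequality $$\varphi^{-1}\left(\int_{\mathbb G}\varphi(|u|+|v|)\,dx\right)\le\varphi^{-1}\left(\int_{\mathbb G}\varphi(|u|)\,dx\right)+\varphi^{-1}\left(\int_{\mathbb G}\varphi(|v|)\,dx\right)\qquad\text{for all }u,v\in L^\varphi(\mathbb G),$$ where $\varphi^{-1}:[0,\infty)\to[0,\infty)$ is the inverse of $\varphi$. Then, for every $s_0\in(0,1)$ and every $u\in W^{s_0,\varphi}(\mathbb G)$, $$2\,\frac{QC_b}{p^+}\,\Phi_\varphi(u)\le\liminf_{s\downarrow0}s\,\Phi_{s,\varphi}(u)\le\limsup_{s\downarrow0}s\,\Phi_{s,\varphi}(u)\le2\,\frac{QC_b}{p^-}\,\Phi_\varphi(u).$$ In particular, if $\lim_{s\downarrow0}s\,\Phi_{s,\varphi}(u)$ exists, then $$2\,\frac{QC_b}{p^+}\,\Phi_\varphi(u)\le\lim_{s\downarrow0}s\,\Phi_{s,\varphi}(u)\le2\,\frac{QC_b}{p^-}\,\Phi_\varphi(u).$$ -/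

import Mathlib

open MeasureTheory Set Filter Topology
open scoped ENNReal Manifold ContDiff

/-! ### Carnot groups in exponential coordinates -/

/-- The underlying space `ℝⁿ` of a Carnot group. It carries the Lebesgue measure `volume` and the
trivial manifold structure; the (non-commutative) group law is a separate multiplicative `Group`
structure. -/
abbrev CarnotSpace (n : ℕ) : Type := EuclideanSpace ℝ (Fin n)

/-- The dilation `δ_r (x₁, …, xₙ) = (r ^ d₁ x₁, …, r ^ dₙ xₙ)`. -/
noncomputable def dilation {n : ℕ} (d : Fin n → ℕ) (r : ℝ) (x : CarnotSpace n) : CarnotSpace n :=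
  WithLp.toLp 2 (fun j => r ^ d j * x j)

/-- The `i`-th layer: the vectors whose nonzero coordinates all have degree `i`. -/
def layer {n : ℕ} (d : Fin n → ℕ) (i : ℕ) : Submodule ℝ (CarnotSpace n) where
  carrier := {v | ∀ j, d j ≠ i → v j = 0}
  add_mem' := by
    intro v w hv hw j hj
    simp [hv j hj, hw j hj]
  zero_mem' := by
    intro j _
    simp
  smul_mem' := by
    intro c v hv j hj
    simp [hv j hj]

/-- The bracket of the Lie algebra of a group law on `ℝⁿ` (the bracket of left-invariant vector
fields, evaluated at the identity); tangent vectors at the identity are vectors of `ℝⁿ`. -/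
noncomputable def tangentBracket {n : ℕ} [Group (CarnotSpace n)] (v w : CarnotSpace n) :
    CarnotSpace n :=
  Bracket.bracket (L := GroupLieAlgebra 𝓘(ℝ, CarnotSpace n) (CarnotSpace n))
    (M := GroupLieAlgebra 𝓘(ℝ, CarnotSpace n) (CarnotSpace n)) v w

/-- The group law on `ℝⁿ` is that of a (nontrivial) Carnot group, written in exponential
coordinates with respect to a basis adapted to the stratification, the `j`-th basis vector lying
in the layer `V_{d j}`. As a group on `ℝⁿ` it is connected and simply connected; the
decomposition `𝔤 = V₁ ⊕ V₂ ⊕ ⋯` into layers is the one given by the coordinates, `V_i = 0` for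
`i` larger than all `d j`, and nilpotency follows from `[V₁, V_i] = V_{i+1}`. -/
structure IsCarnotGroup {n : ℕ} [Group (CarnotSpace n)] (d : Fin n → ℕ) : Prop where
  /-- The group is not trivial. -/
  dim_pos : 0 < n
  /-- Multiplication and inversion are smooth. -/
  lieGroup : LieGroup 𝓘(ℝ, CarnotSpace n) ∞ (CarnotSpace n)
  /-- The coordinates are exponential: `t ↦ t • v` is the one-parameter subgroup with initial
  velocity `v`. In particular the origin is the identity. -/
  exp_coord : ∀ (v : CarnotSpace n) (s t : ℝ), (s • v) * (t • v) = (s + t) • v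
  one_le_degree : ∀ j, 1 ≤ d j
  degree_mono : Monotone d
  /-- The stratification `[V₁, V_i] = V_{i+1}`. -/
  stratified : ∀ i, 1 ≤ i →
    Submodule.span ℝ {z | ∃ v ∈ layer d 1, ∃ w ∈ layer d i, tangentBracket v w = z} =
      layer d (i + 1)
  /-- The dilations are automorphisms of the group. -/
  dilation_mul : ∀ r : ℝ, 0 < r → ∀ x y : CarnotSpace n,
    dilation d r (x * y) = dilation d r x * dilation d r y

/-- The homogeneous dimension `Q = ∑ᵢ i dim V_i`, i.e. the sum of the degrees of the
coordinates. -/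
def homDim {n : ℕ} (d : Fin n → ℕ) : ℕ := ∑ j, d j

/-- A homogeneous norm satisfying the triangle inequality. -/
structure IsHomogeneousNorm {n : ℕ} [Group (CarnotSpace n)] (d : Fin n → ℕ)
    (N : CarnotSpace n → ℝ) : Prop where
  continuous : Continuous N
  nonneg : ∀ x, 0 ≤ N x
  eq_zero_iff : ∀ x, N x = 0 ↔ x = 0
  inv : ∀ x, N x⁻¹ = N x
  dilation : ∀ r : ℝ, 0 < r → ∀ x, N (dilation d r x) = r * N x
  abs_sub_le : ∀ x y, |N y - N x| ≤ N (y⁻¹ * x)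
  le_add : ∀ x y, N (y⁻¹ * x) ≤ N x + N y

/-- `C_b`, the Lebesgue measure of the unit ball of the homogeneous norm. -/
noncomputable def unitBallVolume {n : ℕ} (N : CarnotSpace n → ℝ) : ℝ≥0∞ :=
  volume {x : CarnotSpace n | N x < 1}

/-! ### Orlicz functions -/

/-- The conditions on the density `ϕ : [0, ∞) → [0, ∞)` of an Orlicz function (values of `ϕ` at
negative numbers are irrelevant). -/
structure IsOrliczDensity (ϕ : ℝ → ℝ) : Prop where
  zero : ϕ 0 = 0
  pos : ∀ t, 0 < t → 0 < ϕ t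
  mono : MonotoneOn ϕ (Ici 0)
  right_cont : ∀ t, 0 ≤ t → ContinuousWithinAt ϕ (Ici t) t
  tendsto_atTop : Tendsto ϕ atTop atTop

/-- The Orlicz function `φ(t) = ∫₀ᵗ ϕ(s) ds`, for `t ≥ 0`. -/
noncomputable def orlicz (ϕ : ℝ → ℝ) (t : ℝ) : ℝ := ∫ s in (0 : ℝ)..t, ϕ s

/-- The inverse `φ⁻¹ : [0, ∞) → [0, ∞)` of the bijection `φ : [0, ∞) → [0, ∞)`. -/
noncomputable def orliczInv (φ : ℝ → ℝ) (y : ℝ) : ℝ := Function.invFunOn φ (Ici 0) y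

/-! ### Orlicz functionals and spaces -/

/-- `Φ_φ(u) = ∫ φ(|u(x)|) dx`. -/
noncomputable def orliczEnergy {n : ℕ} (φ : ℝ → ℝ) (u : CarnotSpace n → ℝ) : ℝ≥0∞ :=
  ∫⁻ x, ENNReal.ofReal (φ |u x|)

/-- `Φ_{s,φ}(u) = ∬ φ(|u(x) - u(y)| / ‖y⁻¹ x‖ ^ s) dx dy / ‖y⁻¹ x‖ ^ Q`, for `0 < s < 1`. -/
noncomputable def fracOrliczEnergy {n : ℕ} [Group (CarnotSpace n)] (d : Fin n → ℕ)
    (N : CarnotSpace n → ℝ) (φ : ℝ → ℝ) (s : ℝ) (u : CarnotSpace n → ℝ) : ℝ≥0∞ :=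
  ∫⁻ p : CarnotSpace n × CarnotSpace n,
    ENNReal.ofReal
      (φ (|u p.1 - u p.2| / N (p.2⁻¹ * p.1) ^ s) / N (p.2⁻¹ * p.1) ^ homDim d)

/-- The Orlicz–Lebesgue class `L^φ(𝔾)`. -/
def OrliczSpace {n : ℕ} (φ : ℝ → ℝ) : Set (CarnotSpace n → ℝ) :=
  {u | AEMeasurable u volume ∧ orliczEnergy φ u < ⊤}

/-- The fractional Orlicz–Sobolev class `W^{s,φ}(𝔾)`, for `0 < s < 1`. -/
def FracOrliczSobolev {n : ℕ} [Group (CarnotSpace n)] (d : Fin n → ℕ)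
    (N : CarnotSpace n → ℝ) (φ : ℝ → ℝ) (s : ℝ) : Set (CarnotSpace n → ℝ) :=
  {u | u ∈ OrliczSpace φ ∧ fracOrliczEnergy d N φ s u < ⊤}

/-- The Minkowski-type inequality
`φ⁻¹(∫ φ(|u| + |v|)) ≤ φ⁻¹(∫ φ(|u|)) + φ⁻¹(∫ φ(|v|))` for all `u, v ∈ L^φ(𝔾)`. (All three
integrals are finite when `φ` has the doubling property.) -/
def MinkowskiType (n : ℕ) (φ : ℝ → ℝ) : Prop :=
  ∀ u ∈ OrliczSpace (n := n) φ, ∀ v ∈ OrliczSpace (n := n) φ,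
    orliczInv φ (orliczEnergy φ (fun x => |u x| + |v x|)).toReal ≤
      orliczInv φ (orliczEnergy φ u).toReal + orliczInv φ (orliczEnergy φ v).toReal

/-! Substituting `x = y * z` turns the fractional energy into an integral over `z` of the energy of
the increments `u (y * z) - u y`, with kernel depending on `N z` only. As `s` decreases to `0`, the
region `N z < R` contributes at most a constant times the energy of order `s₀` (`exists_near_le`),
which the factor `s` kills. Everything comes from the region `N z ≥ R`.

Suppose first that `u` vanishes where `N ≥ M`, and take `R = 2 * M`. Then `u (y * z)` and `u y` are
never both nonzero, so the far energy is exactly twice the integral of `φ(|u y| / N z ^ s) / N z ^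
Q` (`farEnergy_eq_two_mul_tailEnergy`). Polar coordinates (`tailEnergy_eq`) and `t = a / r ^ s`
give, with `a = |u y|`, `s ∫_R^∞ φ(a / r ^ s) dr / r = ∫_0^{a / R ^ s} φ(t) / t dt`. Since `φ(t) /
t` lies between `ϕ(t) / p⁺` and `ϕ(t) / p⁻`, this lies between `φ(a / R ^ s) / p⁺` and `φ(a / R ^ s)
/ p⁻`, and `R ^ s → 1`.

A general `u` is cut into a part `v` inside the ball `N < M` and a remainder `w` of small Orlicz
energy. The two are separated by `φ(a + b) ≤ θ φ(a) + K φ(b)` with `θ > 1` arbitrary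
(`IsDoublingModular.exists_add_le`). The limits are taken in the order `s → 0`, `M → ∞`, `θ → 1`;
this works because `K` depends on `θ` alone. -/

/-! ### Dilations and the invariance of Lebesgue measure. -/

/-- The dilation as a continuous linear map. -/
noncomputable def dilationCLM {n : ℕ} (d : Fin n → ℕ) (r : ℝ) :
    CarnotSpace n →L[ℝ] CarnotSpace n :=
  LinearMap.toContinuousLinearMap
    { toFun := dilation d r
      map_add' := fun x y => by ext j; simp [dilation, mul_add]
      map_smul' := fun c x => by ext j; simp [dilation, mul_left_comm] }

@[simp] theorem dilationCLM_apply {n : ℕ} (d : Fin n → ℕ) (r : ℝ) (x : CarnotSpace n) :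
    dilationCLM d r x = dilation d r x := rfl

theorem det_dilationCLM {n : ℕ} (d : Fin n → ℕ) (r : ℝ) :
    (dilationCLM d r).det = r ^ homDim d := by
  have h : LinearMap.toMatrix (EuclideanSpace.basisFun (Fin n) ℝ).toBasis
      (EuclideanSpace.basisFun (Fin n) ℝ).toBasis
      (dilationCLM d r : CarnotSpace n →ₗ[ℝ] CarnotSpace n) =
      Matrix.diagonal fun j => r ^ d j := by
    ext i j
    rw [LinearMap.toMatrix_apply]
    by_cases hij : i = j
    · subst hij; simp [dilation]
    · simp [dilation, hij]
  rw [ContinuousLinearMap.det, ← LinearMap.det_toMatrix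
    (EuclideanSpace.basisFun (Fin n) ℝ).toBasis, h, Matrix.det_diagonal,
    Finset.prod_pow_eq_pow_sum, homDim]

theorem dilation_one {n : ℕ} (d : Fin n → ℕ) (x : CarnotSpace n) : dilation d 1 x = x := by
  ext j; simp [dilation]

theorem continuous_dilation_left {n : ℕ} (d : Fin n → ℕ) (x : CarnotSpace n) :
    Continuous fun r => dilation d r x := by
  unfold dilation; fun_prop

namespace IsCarnotGroup

variable {n : ℕ} [Group (CarnotSpace n)] {d : Fin n → ℕ}

theorem one_eq_zero (hG : IsCarnotGroup d) : (1 : CarnotSpace n) = 0 := by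
  have h := hG.exp_coord 0 0 0
  simp only [smul_zero] at h
  exact (mul_eq_left.1 h).symm

theorem inv_eq_neg (hG : IsCarnotGroup d) (x : CarnotSpace n) : x⁻¹ = -x := by
  have h := hG.exp_coord x (-1) 1
  simp only [neg_smul, one_smul, neg_add_cancel, zero_smul, ← hG.one_eq_zero] at h
  exact (eq_inv_of_mul_eq_one_left h).symm

theorem dilation_zero (hG : IsCarnotGroup d) (x : CarnotSpace n) : dilation d 0 x = 0 := by
  ext j
  have := hG.one_le_degree j
  simp [dilation, show d j ≠ 0 by omega]

theorem contDiff_mul (hG : IsCarnotGroup d) :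
    ContDiff ℝ 1 fun p : CarnotSpace n × CarnotSpace n => p.1 * p.2 := by
  have := hG.lieGroup
  have h := contMDiff_mul 𝓘(ℝ, CarnotSpace n) ∞ (G := CarnotSpace n)
  rw [← modelWithCornersSelf_prod, chartedSpaceSelf_prod, contMDiff_iff_contDiff] at h
  exact h.of_le (by exact_mod_cast le_top)

theorem differentiable_mul_left (hG : IsCarnotGroup d) (x : CarnotSpace n) :
    Differentiable ℝ fun y : CarnotSpace n => x * y :=
  (hG.contDiff_mul.comp (contDiff_const.prodMk contDiff_id)).differentiable one_ne_zero

/-- The Jacobian at the identity of left translations depends continuously on the translation. -/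
theorem continuous_det_fderiv_mul_left (hG : IsCarnotGroup d) :
    Continuous fun x : CarnotSpace n => (fderiv ℝ (fun y : CarnotSpace n => x * y) 0).det := by
  have h : (fun x : CarnotSpace n => fderiv ℝ (fun y : CarnotSpace n => x * y) 0) = fun x =>
      (fderiv ℝ (fun p : CarnotSpace n × CarnotSpace n => p.1 * p.2) (x, 0)).comp
        (ContinuousLinearMap.inr ℝ _ _) := by
    funext x
    have h1 := (hG.contDiff_mul.differentiable one_ne_zero (x, 0)).hasFDerivAt
    exact (h1.comp (0 : CarnotSpace n) (hasFDerivAt_prodMk_right x 0)).fderiv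
  have h2 : Continuous fun x : CarnotSpace n =>
      fderiv ℝ (fun y : CarnotSpace n => x * y) 0 := by
    rw [h]
    have := hG.contDiff_mul.continuous_fderiv one_ne_zero
    fun_prop
  exact ContinuousLinearMap.continuous_det.comp h2

/-- Dilations conjugate one left translation into the other, and the two determinants of the
dilation cancel. -/
theorem det_fderiv_mul_left_dilation (hG : IsCarnotGroup d) {r : ℝ} (hr : 0 < r)
    (x : CarnotSpace n) :
    (fderiv ℝ (fun y : CarnotSpace n => dilation d r x * y) 0).det =
      (fderiv ℝ (fun y : CarnotSpace n => x * y) 0).det := by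
  have h : (fun y : CarnotSpace n => dilation d r x * y) ∘ dilationCLM d r =
      dilationCLM d r ∘ fun y : CarnotSpace n => x * y := by
    funext y; simp [hG.dilation_mul r hr]
  have h0 : dilationCLM d r 0 = 0 := map_zero _
  have h1 := congrArg (fun f => (fderiv ℝ f 0).det) h
  beta_reduce at h1
  rw [fderiv_comp _ (hG.differentiable_mul_left _ _) (dilationCLM d r).differentiableAt,
    fderiv_comp _ (dilationCLM d r).differentiableAt (hG.differentiable_mul_left _ _), h0,
    ContinuousLinearMap.fderiv, ContinuousLinearMap.fderiv] at h1
  simp only [ContinuousLinearMap.det, ContinuousLinearMap.toLinearMap_comp, LinearMap.det_comp] at h1 ⊢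
  have h2 := det_dilationCLM d r
  rw [ContinuousLinearMap.det] at h2
  rw [h2, mul_comm] at h1
  exact mul_left_cancel₀ (pow_ne_zero _ hr.ne') h1

/-- The Jacobian is constant along `r ↦ dilation d r x` and continuous, so it can be evaluated in
the limit `r → 0`, where the translation is the identity map. -/
theorem det_fderiv_mul_left_zero (hG : IsCarnotGroup d) (x : CarnotSpace n) :
    (fderiv ℝ (fun y : CarnotSpace n => x * y) 0).det = 1 := by
  have h1 : Tendsto (fun r : ℝ => (fderiv ℝ (fun y : CarnotSpace n => dilation d r x * y) 0).det)
      (𝓝[>] 0) (𝓝 (fderiv ℝ (fun y : CarnotSpace n => dilation d 0 x * y) 0).det) :=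
    ((hG.continuous_det_fderiv_mul_left.comp (continuous_dilation_left d x)).tendsto 0).mono_left
      nhdsWithin_le_nhds
  have h2 : Tendsto (fun r : ℝ => (fderiv ℝ (fun y : CarnotSpace n => dilation d r x * y) 0).det)
      (𝓝[>] 0) (𝓝 (fderiv ℝ (fun y : CarnotSpace n => x * y) 0).det) :=
    tendsto_const_nhds.congr' <| eventually_mem_nhdsWithin.mono fun r hr =>
      (hG.det_fderiv_mul_left_dilation hr x).symm
  rw [tendsto_nhds_unique h2 h1, hG.dilation_zero, ← hG.one_eq_zero]
  simp [ContinuousLinearMap.det]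

theorem det_fderiv_mul_left (hG : IsCarnotGroup d) (x y : CarnotSpace n) :
    (fderiv ℝ (fun y : CarnotSpace n => x * y) y).det = 1 := by
  have h : (fun z : CarnotSpace n => x * y * z) =
      (fun z : CarnotSpace n => x * z) ∘ fun z : CarnotSpace n => y * z := by
    funext z; simp [mul_assoc]
  have h1 := hG.det_fderiv_mul_left_zero (x * y)
  rw [h, fderiv_comp _ (hG.differentiable_mul_left _ _) (hG.differentiable_mul_left _ _)] at h1
  have h2 := hG.det_fderiv_mul_left_zero y
  have h3 : y * 0 = y := by rw [← hG.one_eq_zero, mul_one]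
  simp only [ContinuousLinearMap.det, ContinuousLinearMap.toLinearMap_comp, LinearMap.det_comp,
    h3] at h1 h2 ⊢
  rwa [h2, mul_one] at h1

theorem isTopologicalGroup (hG : IsCarnotGroup d) : IsTopologicalGroup (CarnotSpace n) := by
  have := hG.lieGroup
  exact topologicalGroup_of_lieGroup 𝓘(ℝ, CarnotSpace n) ∞

/-- The Lebesgue measure is a left Haar measure. -/
theorem isMulLeftInvariant_volume (hG : IsCarnotGroup d) :
    (volume : Measure (CarnotSpace n)).IsMulLeftInvariant := by
  have := hG.isTopologicalGroup
  refine ⟨fun x => ?_⟩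
  ext s hs
  rw [Measure.map_apply (measurable_const_mul x) hs]
  have h := lintegral_abs_det_fderiv_eq_addHaar_image volume
    (measurable_const_mul x hs) (f := fun y : CarnotSpace n => x * y)
    (fun y _ => ((hG.differentiable_mul_left x) y).hasFDerivAt.hasFDerivWithinAt)
    (mul_right_injective x).injOn
  rw [image_preimage_eq s (mul_left_surjective x)] at h
  simpa [hG.det_fderiv_mul_left] using h

theorem lintegral_inv (hG : IsCarnotGroup d) (f : CarnotSpace n → ℝ≥0∞) :
    ∫⁻ x, f x⁻¹ = ∫⁻ x, f x := by
  simp only [hG.inv_eq_neg]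
  exact lintegral_neg_eq_self f

theorem lintegral_mul_left (hG : IsCarnotGroup d) (f : CarnotSpace n → ℝ≥0∞)
    (y : CarnotSpace n) : ∫⁻ x, f (y * x) = ∫⁻ x, f x := by
  have := hG.isTopologicalGroup
  have := hG.isMulLeftInvariant_volume
  exact lintegral_mul_left_eq_self f y

/-- Inversion is `x ↦ -x`, which preserves Lebesgue measure and exchanges left and right
translations. -/
theorem lintegral_mul_right (hG : IsCarnotGroup d) (f : CarnotSpace n → ℝ≥0∞)
    (y : CarnotSpace n) : ∫⁻ x, f (x * y) = ∫⁻ x, f x := by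
  rw [← hG.lintegral_inv fun x => f (x * y), ← hG.lintegral_inv f,
    ← hG.lintegral_mul_left (fun x => f x⁻¹) y⁻¹]
  simp

end IsCarnotGroup

/-! ### Doubling modulars and Orlicz functions. -/

/-- A nondecreasing function on `[0, ∞)` vanishing at the origin whose values grow by a factor
arbitrarily close to `1` under dilations of the argument by a factor close to `1`. -/
structure IsDoublingModular (φ : ℝ → ℝ) : Prop where
  zero : φ 0 = 0
  mono : MonotoneOn φ (Ici 0)
  exists_dilate_le : ∀ θ : ℝ, 1 < θ → ∃ η : ℝ, 0 < η ∧ ∀ t, 0 ≤ t → φ ((1 + η) * t) ≤ θ * φ t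

namespace IsDoublingModular

variable {φ : ℝ → ℝ}

theorem le (h : IsDoublingModular φ) {a b : ℝ} (ha : 0 ≤ a) (hab : a ≤ b) : φ a ≤ φ b :=
  h.mono ha (ha.trans hab) hab

theorem nonneg (h : IsDoublingModular φ) {a : ℝ} (ha : 0 ≤ a) : 0 ≤ φ a :=
  h.zero ▸ h.le le_rfl ha

theorem exists_mul_le (h : IsDoublingModular φ) (c : ℝ) (hc : 0 ≤ c) :
    ∃ K : ℝ, 0 ≤ K ∧ ∀ t, 0 ≤ t → φ (c * t) ≤ K * φ t := by
  obtain ⟨η, hη, H⟩ := h.exists_dilate_le 2 one_lt_two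
  have Hk : ∀ k : ℕ, ∀ t, 0 ≤ t → φ ((1 + η) ^ k * t) ≤ 2 ^ k * φ t := by
    intro k
    induction k with
    | zero => intro t _; simp
    | succ k ih =>
      intro t ht
      calc φ ((1 + η) ^ (k + 1) * t) = φ ((1 + η) * ((1 + η) ^ k * t)) := by ring_nf
        _ ≤ 2 * φ ((1 + η) ^ k * t) := H _ (by positivity)
        _ ≤ 2 * (2 ^ k * φ t) := by linarith [ih t ht]
        _ = 2 ^ (k + 1) * φ t := by ring
  obtain ⟨k, hk⟩ := pow_unbounded_of_one_lt c (show (1 : ℝ) < 1 + η by linarith)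
  exact ⟨2 ^ k, by positivity, fun t ht =>
    (h.le (by positivity) (mul_le_mul_of_nonneg_right hk.le ht)).trans (Hk k t ht)⟩

/-- If `b ≤ η * a`, the sum is a small dilation of `a` and costs only `θ`; otherwise `a` is at most
a multiple of `b`, and doubling absorbs it into `K`. -/
theorem exists_add_le (h : IsDoublingModular φ) (θ : ℝ) (hθ : 1 < θ) :
    ∃ K : ℝ, 0 ≤ K ∧ ∀ a b, 0 ≤ a → 0 ≤ b → φ (a + b) ≤ θ * φ a + K * φ b := by
  obtain ⟨η, hη, H⟩ := h.exists_dilate_le θ hθ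
  obtain ⟨K, hK, HK⟩ := h.exists_mul_le (1 + 1 / η) (by positivity)
  refine ⟨K, hK, fun a b ha hb => ?_⟩
  have hφa := h.nonneg ha
  have hφb := h.nonneg hb
  rcases le_total b (η * a) with hba | hba
  · have := (h.le (by positivity) (show a + b ≤ (1 + η) * a by linarith)).trans (H a ha)
    nlinarith [mul_nonneg hK hφb]
  · have h1 : a ≤ 1 / η * b := by
      rw [one_div, inv_mul_eq_div, le_div_iff₀ hη]; linarith
    have := (h.le (by positivity) (show a + b ≤ (1 + 1 / η) * b by linarith)).trans (HK b hb)
    nlinarith [mul_nonneg (zero_le_one.trans hθ.le) hφa]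

theorem measurable_comp (h : IsDoublingModular φ) {α : Type*} [MeasurableSpace α] {g : α → ℝ}
    (hg : Measurable g) (hg0 : ∀ x, 0 ≤ g x) : Measurable fun x => φ (g x) := by
  -- Nothing is known about `φ` at negative arguments, so it is made globally monotone by cutting
  -- the argument off at `0`.
  have h1 : Monotone fun t => φ (max t 0) := fun a b hab =>
    h.le (le_max_right _ _) (max_le_max_right 0 hab)
  have h2 : (fun x => φ (g x)) = (fun t => φ (max t 0)) ∘ g := by
    funext x; simp [max_eq_left (hg0 x)]
  rw [h2]
  exact h1.measurable.comp hg

end IsDoublingModular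

namespace IsOrliczDensity

variable {ϕ : ℝ → ℝ}

theorem nonneg (h : IsOrliczDensity ϕ) {t : ℝ} (ht : 0 ≤ t) : 0 ≤ ϕ t :=
  h.zero ▸ h.mono self_mem_Ici ht ht

theorem intervalIntegrable (h : IsOrliczDensity ϕ) {a b : ℝ} (ha : 0 ≤ a) (hb : 0 ≤ b) :
    IntervalIntegrable ϕ volume a b :=
  (h.mono.mono fun _ hx => (le_min ha hb).trans hx.1).intervalIntegrable

theorem orlicz_sub_orlicz (h : IsOrliczDensity ϕ) {a b : ℝ} (ha : 0 ≤ a) (hb : 0 ≤ b) :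
    orlicz ϕ b - orlicz ϕ a = ∫ t in a..b, ϕ t :=
  intervalIntegral.integral_interval_sub_left (h.intervalIntegrable le_rfl hb)
    (h.intervalIntegrable le_rfl ha)

theorem monotoneOn_orlicz (h : IsOrliczDensity ϕ) : MonotoneOn (orlicz ϕ) (Ici 0) := by
  intro a ha b hb hab
  have := intervalIntegral.integral_nonneg (μ := volume) hab
    fun t ht => h.nonneg (le_trans ha ht.1)
  linarith [h.orlicz_sub_orlicz ha hb]

theorem ofReal_orlicz (h : IsOrliczDensity ϕ) {b : ℝ} (hb : 0 ≤ b) :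
    ENNReal.ofReal (orlicz ϕ b) = ∫⁻ t in Ioc 0 b, ENNReal.ofReal (ϕ t) := by
  rw [orlicz, intervalIntegral.integral_of_le hb]
  refine ofReal_integral_eq_lintegral_ofReal
    ((intervalIntegrable_iff_integrableOn_Ioc_of_le hb).1 (h.intervalIntegrable le_rfl hb)) ?_
  exact (ae_restrict_mem measurableSet_Ioc).mono fun t ht => h.nonneg ht.1.le

theorem orlicz_zero : orlicz ϕ 0 = 0 := by simp [orlicz]

/-- With `T = (1 + η) * t`, monotonicity of `ϕ` gives `φ(T) - φ(t) ≤ (T - t) ϕ(T) ≤ η T ϕ(T) ≤ η p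
φ(T)`. The choice `η p = 1 - θ⁻¹` makes this `θ⁻¹ φ(T) ≤ φ(t)`. -/
theorem isDoublingModular_orlicz (h : IsOrliczDensity ϕ) {p : ℝ} (hp0 : 0 < p)
    (hp : ∀ t, 0 < t → t * ϕ t ≤ p * orlicz ϕ t) : IsDoublingModular (orlicz ϕ) := by
  refine ⟨orlicz_zero, h.monotoneOn_orlicz, fun θ hθ => ⟨(1 - θ⁻¹) / p, ?_, fun t ht => ?_⟩⟩
  · have := inv_lt_one_of_one_lt₀ hθ
    exact div_pos (by linarith) hp0
  have hinv : θ⁻¹ < 1 := inv_lt_one_of_one_lt₀ hθ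
  set η := (1 - θ⁻¹) / p with hη
  have hη0 : 0 < η := div_pos (by linarith) hp0
  rcases ht.eq_or_lt with rfl | ht
  · simp [orlicz_zero]
  have hT : 0 < (1 + η) * t := by positivity
  have htT : t ≤ (1 + η) * t := by nlinarith
  have h1 : ∫ x in t..(1 + η) * t, ϕ x ≤ ∫ _ in t..(1 + η) * t, ϕ ((1 + η) * t) :=
    intervalIntegral.integral_mono_on htT (h.intervalIntegrable ht.le hT.le) (by simp)
      fun x hx => h.mono (ht.le.trans hx.1) hT.le hx.2
  rw [intervalIntegral.integral_const, ← h.orlicz_sub_orlicz ht.le hT.le, smul_eq_mul] at h1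
  have h2 := hp _ hT
  have h3 : 0 ≤ ϕ ((1 + η) * t) := h.nonneg hT.le
  have h4 : ((1 + η) * t - t) * ϕ ((1 + η) * t) ≤ η * ((1 + η) * t * ϕ ((1 + η) * t)) := by
    have : 0 ≤ η * η * (t * ϕ ((1 + η) * t)) := by positivity
    nlinarith
  have h5 : η * p = 1 - θ⁻¹ := by rw [hη]; field_simp
  have h6 : η * ((1 + η) * t * ϕ ((1 + η) * t)) ≤ (1 - θ⁻¹) * orlicz ϕ ((1 + η) * t) := by
    rw [← h5, mul_assoc η p]; exact mul_le_mul_of_nonneg_left h2 hη0.le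
  have h7 : θ⁻¹ * orlicz ϕ ((1 + η) * t) ≤ orlicz ϕ t := by linarith
  rwa [inv_mul_le_iff₀ (by linarith)] at h7

end IsOrliczDensity

/-! ### The radial integral. -/

theorem image_div_rpow_Ici {a R s : ℝ} (ha : 0 < a) (hR : 0 < R) (hs : 0 < s) :
    (fun r : ℝ => a / r ^ s) '' Ici R = Ioc 0 (a / R ^ s) := by
  ext t
  constructor
  · rintro ⟨r, hr, rfl⟩
    have hr' : R ≤ r := hr
    have hr0 : 0 < r := hR.trans_le hr'
    refine ⟨by positivity, ?_⟩
    dsimp only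
    gcongr
  · rintro ⟨ht, ht'⟩
    have hR' := Real.rpow_pos_of_pos hR s
    refine ⟨(a / t) ^ s⁻¹, ?_, ?_⟩
    · rw [mem_Ici, Real.le_rpow_inv_iff_of_pos hR.le (by positivity) hs, le_div_iff₀ ht]
      rwa [le_div_iff₀ hR', mul_comm] at ht'
    · dsimp only
      rw [Real.rpow_inv_rpow (by positivity) hs.ne']
      field_simp

/-- The substitution `t = a / r ^ s`. -/
theorem ofReal_mul_lintegral_Ici_div_rpow (φ : ℝ → ℝ) {a R s : ℝ} (ha : 0 < a) (hR : 0 < R)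
    (hs : 0 < s) :
    ENNReal.ofReal s * ∫⁻ r in Ici R, ENNReal.ofReal (φ (a / r ^ s) / r) =
      ∫⁻ t in Ioc 0 (a / R ^ s), ENNReal.ofReal (φ t / t) := by
  have hinj : InjOn (fun r : ℝ => a / r ^ s) (Ici R) := by
    intro r hr r' hr' h
    have h0 : 0 < r := hR.trans_le hr
    have h0' : 0 < r' := hR.trans_le hr'
    have h1 : r ^ s = r' ^ s := by
      have := Real.rpow_pos_of_pos h0 s
      have := Real.rpow_pos_of_pos h0' s
      simp only at h
      field_simp at h
      exact h.symm
    exact (Real.rpow_left_inj h0.le h0'.le hs.ne').1 h1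
  have hderiv : ∀ r ∈ Ici R, HasDerivWithinAt (fun r : ℝ => a / r ^ s)
      (-(s * (a / r ^ s) / r)) (Ici R) r := by
    intro r hr
    have h0 : 0 < r := hR.trans_le hr
    have h1 : HasDerivAt (fun r : ℝ => a * r ^ (-s)) (a * (-s * r ^ (-s - 1))) r :=
      (Real.hasDerivAt_rpow_const (Or.inl h0.ne')).const_mul a
    have h2 : a * (-s * r ^ (-s - 1)) = -(s * (a / r ^ s) / r) := by
      rw [Real.rpow_sub h0, Real.rpow_neg h0.le, Real.rpow_one]; field_simp
    rw [h2] at h1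
    refine h1.hasDerivWithinAt.congr_of_mem (fun x hx => ?_) hr
    rw [Real.rpow_neg (hR.le.trans hx), div_eq_mul_inv]
  rw [← image_div_rpow_Ici ha hR hs,
    lintegral_image_eq_lintegral_abs_deriv_mul measurableSet_Ici hderiv hinj,
    ← lintegral_const_mul' _ _ ENNReal.ofReal_ne_top]
  refine setLIntegral_congr_fun measurableSet_Ici fun r hr => ?_
  have h0 : 0 < r := hR.trans_le hr
  have h1 := Real.rpow_pos_of_pos h0 s
  rw [← ENNReal.ofReal_mul hs.le, ← ENNReal.ofReal_mul (abs_nonneg _), abs_neg,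
    abs_of_pos (by positivity)]
  congr 1
  field_simp

namespace IsOrliczDensity

variable {ϕ : ℝ → ℝ}

/-- After the substitution both sides are integrals over the same interval, and the growth condition
compares `ϕ(t)` with `p φ(t) / t` pointwise. -/
theorem radial_lower (h : IsOrliczDensity ϕ) {p : ℝ} (hp0 : 0 < p)
    (hp : ∀ t, 0 < t → t * ϕ t ≤ p * orlicz ϕ t) {a R s : ℝ} (ha : 0 ≤ a) (hR : 0 < R)
    (hs : 0 < s) :
    ENNReal.ofReal (orlicz ϕ (a / R ^ s)) ≤ ENNReal.ofReal p *
      (ENNReal.ofReal s * ∫⁻ r in Ici R, ENNReal.ofReal (orlicz ϕ (a / r ^ s) / r)) := by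
  rcases ha.eq_or_lt with rfl | ha
  · simp [orlicz_zero]
  rw [ofReal_mul_lintegral_Ici_div_rpow _ ha hR hs, h.ofReal_orlicz (by positivity),
    ← lintegral_const_mul' _ _ ENNReal.ofReal_ne_top]
  refine setLIntegral_mono' measurableSet_Ioc fun t ht => ?_
  rw [← ENNReal.ofReal_mul hp0.le]
  refine ENNReal.ofReal_le_ofReal ?_
  rw [← mul_div_assoc, le_div_iff₀ ht.1, mul_comm]
  exact hp t ht.1

theorem radial_upper (h : IsOrliczDensity ϕ) {p : ℝ} (hp0 : 0 < p)
    (hp : ∀ t, 0 < t → p * orlicz ϕ t ≤ t * ϕ t) {a R s : ℝ} (ha : 0 ≤ a) (hR : 0 < R)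
    (hs : 0 < s) :
    ENNReal.ofReal p *
      (ENNReal.ofReal s * ∫⁻ r in Ici R, ENNReal.ofReal (orlicz ϕ (a / r ^ s) / r)) ≤
      ENNReal.ofReal (orlicz ϕ (a / R ^ s)) := by
  rcases ha.eq_or_lt with rfl | ha
  · simp [orlicz_zero]
  rw [ofReal_mul_lintegral_Ici_div_rpow _ ha hR hs, h.ofReal_orlicz (by positivity),
    ← lintegral_const_mul' _ _ ENNReal.ofReal_ne_top]
  refine setLIntegral_mono' measurableSet_Ioc fun t ht => ?_
  rw [← ENNReal.ofReal_mul hp0.le]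
  refine ENNReal.ofReal_le_ofReal ?_
  rw [← mul_div_assoc, div_le_iff₀ ht.1, mul_comm (ϕ t)]
  exact hp t ht.1

end IsOrliczDensity

/-! ### Homogeneous norms and polar coordinates. -/

theorem IsCarnotGroup.homDim_pos {n : ℕ} [Group (CarnotSpace n)] {d : Fin n → ℕ}
    (hG : IsCarnotGroup d) : 0 < homDim d := by
  refine Finset.sum_pos (fun j _ => hG.one_le_degree j) ⟨⟨0, hG.dim_pos⟩, Finset.mem_univ _⟩

theorem lintegral_pow_Ico {k : ℕ} (hk : 0 < k) {a b : ℝ} (ha : 0 ≤ a) (hab : a ≤ b) :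
    ∫⁻ r in Ico a b, ENNReal.ofReal (k * r ^ (k - 1)) = ENNReal.ofReal (b ^ k - a ^ k) := by
  rw [setLIntegral_congr Ico_ae_eq_Ioc, ← ofReal_integral_eq_lintegral_ofReal,
    ← intervalIntegral.integral_of_le hab, intervalIntegral.integral_const_mul, integral_pow]
  · congr 1
    have hk' : k - 1 + 1 = k := by omega
    have : (((k - 1 : ℕ) : ℝ) + 1) = k := by exact_mod_cast hk'
    rw [hk', this]
    field_simp
  · exact ((by fun_prop : Continuous fun r : ℝ => (k : ℝ) * r ^ (k - 1)).integrableOn_Icc).mono_set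
      Ioc_subset_Icc_self
  · refine (ae_restrict_mem measurableSet_Ioc).mono fun r hr => ?_
    have : 0 < r := ha.trans_lt hr.1
    simp only [Pi.zero_apply]
    positivity

namespace IsHomogeneousNorm

variable {n : ℕ} [Group (CarnotSpace n)] {d : Fin n → ℕ} {N : CarnotSpace n → ℝ}

/-- Let `m > 0` be the minimum of `N` on the Euclidean unit sphere. A point outside the Euclidean
unit ball is dilated onto the sphere by some `r ≤ 1`; homogeneity and `N x < 1` force `r ≥ m`, which
bounds each coordinate by `m⁻¹ ^ d j`. -/
theorem isBounded_unitBall (hG : IsCarnotGroup d) (hN : IsHomogeneousNorm d N) :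
    Bornology.IsBounded {x : CarnotSpace n | N x < 1} := by
  have : NeZero n := ⟨hG.dim_pos.ne'⟩
  have : Nontrivial (CarnotSpace n) := inferInstance
  obtain ⟨x₀, hx₀, hmin⟩ := (isCompact_sphere (0 : CarnotSpace n) 1).exists_isMinOn
    (NormedSpace.sphere_nonempty.2 zero_le_one) hN.continuous.continuousOn
  have hx₀' : x₀ ≠ 0 := by rintro rfl; simp at hx₀
  set m := N x₀
  have hm : 0 < m := lt_of_le_of_ne (hN.nonneg _) fun h => hx₀' ((hN.eq_zero_iff _).1 h.symm)
  refine (Metric.isBounded_ball (x := (0 : CarnotSpace n))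
    (r := ∑ j, (m⁻¹) ^ d j + 2)).subset fun x hx => ?_
  rw [mem_ball_zero_iff]
  have hpos : 0 ≤ ∑ j, (m⁻¹) ^ d j := Finset.sum_nonneg fun _ _ => by positivity
  rcases lt_or_ge ‖x‖ 1 with h1 | h1
  · linarith
  obtain ⟨r, hr, hrx⟩ : (1 : ℝ) ∈ (fun r => ‖_root_.dilation d r x‖) '' Icc 0 1 := by
    refine intermediate_value_Icc zero_le_one (continuous_dilation_left d x).norm.continuousOn ?_
    simp [hG.dilation_zero, dilation_one, h1]
  simp only at hrx
  have hr0 : 0 < r := by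
    refine lt_of_le_of_ne hr.1 ?_
    rintro rfl
    simp [hG.dilation_zero] at hrx
  have hmr : m ≤ r := by
    have h2 : m ≤ N (_root_.dilation d r x) := hmin (by simpa using hrx)
    rw [hN.dilation r hr0] at h2
    have h3 : N x < 1 := hx
    nlinarith
  have hcoord : ∀ j, ‖x j‖ ≤ (m⁻¹) ^ d j := by
    intro j
    have h2 : ‖r ^ d j * x j‖ ≤ 1 := by
      rw [← hrx]; exact PiLp.norm_apply_le (_root_.dilation d r x) j
    rw [norm_mul, norm_pow, Real.norm_of_nonneg hr0.le] at h2
    have h4 : m ^ d j * ‖x j‖ ≤ 1 :=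
      (mul_le_mul_of_nonneg_right (pow_le_pow_left₀ hm.le hmr _) (norm_nonneg _)).trans h2
    rw [inv_pow, ← one_div, le_div_iff₀ (by positivity), mul_comm]
    exact h4
  have hsum : ‖x‖ ≤ ∑ j, ‖x j‖ := by
    rw [EuclideanSpace.norm_eq]
    refine Real.sqrt_le_iff.2 ⟨Finset.sum_nonneg fun _ _ => norm_nonneg _, ?_⟩
    exact Finset.sum_sq_le_sq_sum_of_nonneg fun _ _ => norm_nonneg _
  have := Finset.sum_le_sum fun j (_ : j ∈ Finset.univ) => hcoord j
  linarith

theorem unitBallVolume_ne_top (hG : IsCarnotGroup d) (hN : IsHomogeneousNorm d N) :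
    unitBallVolume N ≠ ⊤ :=
  (hN.isBounded_unitBall hG).measure_lt_top.ne

theorem volume_lt (hN : IsHomogeneousNorm d N) {r : ℝ} (hr : 0 < r) :
    volume {x : CarnotSpace n | N x < r} = ENNReal.ofReal (r ^ homDim d) * unitBallVolume N := by
  have h : {x : CarnotSpace n | N x < r} =
      (dilationCLM d r⁻¹ : CarnotSpace n →ₗ[ℝ] CarnotSpace n) ⁻¹' {x | N x < 1} := by
    ext x
    simp [hN.dilation r⁻¹ (inv_pos.2 hr), inv_mul_lt_iff₀ hr]
  have hdet : LinearMap.det (dilationCLM d r⁻¹ : CarnotSpace n →ₗ[ℝ] CarnotSpace n) =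
      r⁻¹ ^ homDim d := det_dilationCLM d r⁻¹
  rw [h, Measure.addHaar_preimage_linearMap _ (by rw [hdet]; positivity), hdet, unitBallVolume,
    inv_pow, inv_inv, abs_of_pos (by positivity)]

theorem volume_mem_Ico (hG : IsCarnotGroup d) (hN : IsHomogeneousNorm d N) {a b : ℝ} (ha : 0 < a)
    (hab : a ≤ b) : volume {x : CarnotSpace n | N x ∈ Ico a b} =
      unitBallVolume N * ∫⁻ r in Ico a b, ENNReal.ofReal (homDim d * r ^ (homDim d - 1)) := by
  have h : {x : CarnotSpace n | N x ∈ Ico a b} = {x | N x < b} \ {x | N x < a} := by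
    ext x; simp [and_comm]
  have hsub : {x : CarnotSpace n | N x < a} ⊆ {x | N x < b} := fun x hx => lt_of_lt_of_le hx hab
  rw [h, measure_sdiff hsub
    (measurableSet_lt hN.continuous.measurable measurable_const).nullMeasurableSet,
    hN.volume_lt ha, hN.volume_lt (ha.trans_le hab),
    lintegral_pow_Ico (hG.homDim_pos) ha.le hab, ENNReal.ofReal_sub _ (by positivity),
    ENNReal.mul_sub fun _ _ => hN.unitBallVolume_ne_top hG, mul_comm, mul_comm (ENNReal.ofReal _)]
  rw [hN.volume_lt ha]
  exact ENNReal.mul_ne_top ENNReal.ofReal_ne_top (hN.unitBallVolume_ne_top hG)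

/-- Integration in polar coordinates, away from the origin. -/
theorem setLIntegral_comp (hG : IsCarnotGroup d) (hN : IsHomogeneousNorm d N) {R : ℝ} (hR : 0 < R)
    {g : ℝ → ℝ≥0∞} (hg : Measurable g) :
    ∫⁻ x in {x : CarnotSpace n | R ≤ N x}, g (N x) = unitBallVolume N *
      ∫⁻ r in Ici R, ENNReal.ofReal (homDim d * r ^ (homDim d - 1)) * g r := by
  have hNm := hN.continuous.measurable
  have hw : Measurable fun r : ℝ => ENNReal.ofReal (homDim d * r ^ (homDim d - 1)) := by fun_prop
  -- The image of Lebesgue measure under `N` is identified by its values on half-open intervals,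
  -- that is by the volumes of shells, so no surface measure is needed.
  have key : (volume.map N).restrict (Ici R) =
      unitBallVolume N • (volume.restrict (Ici R)).withDensity
        fun r => ENNReal.ofReal (homDim d * r ^ (homDim d - 1)) := by
    have hIco : ∀ a b : ℝ, (volume.map N).restrict (Ici R) (Ico a b) =
        (unitBallVolume N • (volume.restrict (Ici R)).withDensity
          fun r => ENNReal.ofReal (homDim d * r ^ (homDim d - 1))) (Ico a b) := by
      intro a b
      have hset : Ico a b ∩ Ici R = Ico (max a R) b := by
        ext x; simp
      rw [Measure.restrict_apply measurableSet_Ico, Measure.smul_apply,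
        withDensity_apply _ measurableSet_Ico, Measure.restrict_restrict measurableSet_Ico, hset,
        Measure.map_apply hNm measurableSet_Ico, smul_eq_mul]
      rcases le_total (max a R) b with hab | hab
      · exact hN.volume_mem_Ico hG (hR.trans_le (le_max_right _ _)) hab
      · simp [Ico_eq_empty_of_le hab]
    have hfin : ∀ a b : ℝ, (volume.map N).restrict (Ici R) (Ico a b) < ⊤ := by
      intro a b
      refine (Measure.restrict_apply_le _ _).trans_lt ?_
      rw [Measure.map_apply hNm measurableSet_Ico]
      -- `max b 1` ensures a positive radius, as `volume_lt` requires.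
      refine (measure_mono (t := {x | N x < max b 1}) fun x hx =>
        lt_of_lt_of_le hx.2 (le_max_left _ _)).trans_lt ?_
      rw [hN.volume_lt (zero_lt_one.trans_le (le_max_right _ _))]
      exact ENNReal.mul_lt_top ENNReal.ofReal_lt_top (hN.unitBallVolume_ne_top hG).lt_top
    exact Measure.ext_of_Ico' _ _ (fun a b _ => (hfin a b).ne) fun a b _ => hIco a b
  calc ∫⁻ x in {x : CarnotSpace n | R ≤ N x}, g (N x)
      = ∫⁻ r in Ici R, g r ∂(volume.map N) :=
        (setLIntegral_map measurableSet_Ici hg hNm).symm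
    _ = _ := by
        rw [key, lintegral_smul_measure, lintegral_withDensity_eq_lintegral_mul _ hw hg]
        rfl

end IsHomogeneousNorm

/-! ### Near, far and tail energies. -/

theorem IsDoublingModular.measurable_kernel {φ : ℝ → ℝ} (hφ : IsDoublingModular φ) {α : Type*}
    [MeasurableSpace α] {A B : α → ℝ} (hA : Measurable A) (hB : Measurable B)
    (hB0 : ∀ x, 0 ≤ B x) (s : ℝ) (k : ℕ) :
    Measurable fun x => ENNReal.ofReal (φ (|A x| / B x ^ s) / B x ^ k) := by
  have h1 : Measurable fun x => |A x| / B x ^ s := hA.abs.div (hB.pow_const s)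
  have h2 := hφ.measurable_comp h1 fun x =>
    div_nonneg (abs_nonneg _) (Real.rpow_nonneg (hB0 x) s)
  exact (h2.div (hB.pow_const k)).ennreal_ofReal

theorem IsDoublingModular.ofReal_kernel_le {φ : ℝ → ℝ} (hφ : IsDoublingModular φ) {θ K : ℝ}
    (hθ : 0 ≤ θ) (hK : 0 ≤ K)
    (H : ∀ a b, 0 ≤ a → 0 ≤ b → φ (a + b) ≤ θ * φ a + K * φ b) {a b c t : ℝ} (ht : 0 ≤ t)
    (hc : |c| ≤ |a| + |b|) (s : ℝ) (k : ℕ) :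
    ENNReal.ofReal (φ (|c| / t ^ s) / t ^ k) ≤ ENNReal.ofReal θ *
      ENNReal.ofReal (φ (|a| / t ^ s) / t ^ k) + ENNReal.ofReal K *
      ENNReal.ofReal (φ (|b| / t ^ s) / t ^ k) := by
  have hts := Real.rpow_nonneg ht s
  have htk := pow_nonneg ht k
  have hnn (x : ℝ) : 0 ≤ φ (|x| / t ^ s) := hφ.nonneg (by positivity)
  rw [← ENNReal.ofReal_mul hθ, ← ENNReal.ofReal_mul hK, ← ENNReal.ofReal_add
    (mul_nonneg hθ (div_nonneg (hnn _) htk)) (mul_nonneg hK (div_nonneg (hnn _) htk))]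
  refine ENNReal.ofReal_le_ofReal ?_
  rw [← mul_div_assoc, ← mul_div_assoc, ← add_div]
  refine div_le_div_of_nonneg_right ((hφ.le (by positivity) ?_).trans
    (H _ _ (by positivity) (by positivity))) htk
  rw [← add_div]
  exact div_le_div_of_nonneg_right hc hts

section Energies

variable {n : ℕ} [Group (CarnotSpace n)]

/-- The integral over `N z ≥ R` of the functional `Φ_φ(f / N(z) ^ s) / N(z) ^ Q`. -/
noncomputable def tailEnergy (d : Fin n → ℕ) (N : CarnotSpace n → ℝ) (φ : ℝ → ℝ) (s R : ℝ)
    (f : CarnotSpace n → ℝ) : ℝ≥0∞ :=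
  ∫⁻ z in {z : CarnotSpace n | R ≤ N z}, ∫⁻ y,
    ENNReal.ofReal (φ (|f y| / N z ^ s) / N z ^ homDim d)

/-- The energy of the increments `f (y z) - f y`. -/
noncomputable def incrementEnergy (d : Fin n → ℕ) (N : CarnotSpace n → ℝ) (φ : ℝ → ℝ) (s : ℝ)
    (f : CarnotSpace n → ℝ) (z : CarnotSpace n) : ℝ≥0∞ :=
  ∫⁻ y, ENNReal.ofReal (φ (|f (y * z) - f y| / N z ^ s) / N z ^ homDim d)

/-- The part over `N z ≥ R` of the fractional energy. -/
noncomputable def farEnergy (d : Fin n → ℕ) (N : CarnotSpace n → ℝ) (φ : ℝ → ℝ) (s R : ℝ)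
    (f : CarnotSpace n → ℝ) : ℝ≥0∞ :=
  ∫⁻ z in {z : CarnotSpace n | R ≤ N z}, incrementEnergy d N φ s f z

variable {d : Fin n → ℕ} {N : CarnotSpace n → ℝ} {φ : ℝ → ℝ} {f g : CarnotSpace n → ℝ}

theorem measurable_increment_kernel (hG : IsCarnotGroup d) (hN : IsHomogeneousNorm d N)
    (hφ : IsDoublingModular φ) (hf : Measurable f) (s : ℝ) :
    Measurable fun p : CarnotSpace n × CarnotSpace n =>
      ENNReal.ofReal (φ (|f (p.2 * p.1) - f p.2| / N p.1 ^ s) / N p.1 ^ homDim d) := by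
  have hmul : Measurable fun p : CarnotSpace n × CarnotSpace n => p.2 * p.1 :=
    hG.contDiff_mul.continuous.measurable.comp measurable_swap
  exact hφ.measurable_kernel ((hf.comp hmul).sub (hf.comp measurable_snd))
    (hN.continuous.measurable.comp measurable_fst) (fun _ => hN.nonneg _) s _

theorem measurable_incrementEnergy (hG : IsCarnotGroup d) (hN : IsHomogeneousNorm d N)
    (hφ : IsDoublingModular φ) (hf : Measurable f) (s : ℝ) :
    Measurable (incrementEnergy d N φ s f) :=
  (measurable_increment_kernel hG hN hφ hf s).lintegral_prod_right'

theorem measurable_tail_kernel (hN : IsHomogeneousNorm d N)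
    (hφ : IsDoublingModular φ) (hf : Measurable f) (s : ℝ) :
    Measurable fun p : CarnotSpace n × CarnotSpace n =>
      ENNReal.ofReal (φ (|f p.2| / N p.1 ^ s) / N p.1 ^ homDim d) :=
  hφ.measurable_kernel (hf.comp measurable_snd)
    (hN.continuous.measurable.comp measurable_fst) (fun _ => hN.nonneg _) s _

/-- The fractional energy as an integral over increments. -/
theorem fracOrliczEnergy_eq_lintegral (hG : IsCarnotGroup d) (hN : IsHomogeneousNorm d N)
    (hφ : IsDoublingModular φ) (hf : Measurable f) (s : ℝ) :
    fracOrliczEnergy d N φ s f = ∫⁻ z, incrementEnergy d N φ s f z := by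
  have := hG.isTopologicalGroup
  have hmul : Measurable fun p : CarnotSpace n × CarnotSpace n => p.2⁻¹ * p.1 :=
    (by fun_prop : Continuous fun p : CarnotSpace n × CarnotSpace n => p.2⁻¹ * p.1).measurable
  have hm : Measurable fun p : CarnotSpace n × CarnotSpace n => ENNReal.ofReal
      (φ (|f p.1 - f p.2| / N (p.2⁻¹ * p.1) ^ s) / N (p.2⁻¹ * p.1) ^ homDim d) :=
    hφ.measurable_kernel ((hf.comp measurable_fst).sub (hf.comp measurable_snd))
      (hN.continuous.measurable.comp hmul) (fun _ => hN.nonneg _) s _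
  unfold fracOrliczEnergy incrementEnergy
  rw [Measure.volume_eq_prod, lintegral_prod_symm' _ hm, lintegral_lintegral_swap
    (f := fun z y => ENNReal.ofReal (φ (|f (y * z) - f y| / N z ^ s) / N z ^ homDim d))
    (measurable_increment_kernel hG hN hφ hf s).aemeasurable]
  refine lintegral_congr fun y => ?_
  -- For fixed `y`, left invariance replaces `x` by `y * z`, so that `y⁻¹ * x` becomes `z`.
  rw [← hG.lintegral_mul_left _ y]
  simp

theorem fracOrliczEnergy_eq_add (hG : IsCarnotGroup d) (hN : IsHomogeneousNorm d N)
    (hφ : IsDoublingModular φ) (hf : Measurable f) (s R : ℝ) :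
    fracOrliczEnergy d N φ s f =
      (∫⁻ z in {z : CarnotSpace n | R ≤ N z}ᶜ, incrementEnergy d N φ s f z) +
        farEnergy d N φ s R f := by
  rw [fracOrliczEnergy_eq_lintegral hG hN hφ hf, farEnergy, add_comm,
    lintegral_add_compl _ (measurableSet_le measurable_const hN.continuous.measurable)]

theorem farEnergy_le_fracOrliczEnergy (hG : IsCarnotGroup d) (hN : IsHomogeneousNorm d N)
    (hφ : IsDoublingModular φ) (hf : Measurable f) (s R : ℝ) :
    farEnergy d N φ s R f ≤ fracOrliczEnergy d N φ s f := by
  rw [fracOrliczEnergy_eq_add hG hN hφ hf s R]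
  exact le_add_self

/-- The part of the energy near the diagonal is controlled by an energy of higher order. -/
theorem exists_near_le (hG : IsCarnotGroup d) (hN : IsHomogeneousNorm d N)
    (hφ : IsDoublingModular φ) (hf : Measurable f) {s₀ : ℝ} (R : ℝ) :
    ∃ K : ℝ, ∀ s, 0 < s → s ≤ s₀ →
      ∫⁻ z in {z : CarnotSpace n | R ≤ N z}ᶜ, incrementEnergy d N φ s f z ≤
        ENNReal.ofReal K * fracOrliczEnergy d N φ s₀ f := by
  -- This dominates `N z ^ (s₀ - s)` for `N z < R`, uniformly in `s`; a base at least `1` allows the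
  -- exponent to be raised to `s₀`.
  obtain ⟨K, hK, H⟩ := hφ.exists_mul_le (max R 1 ^ s₀)
    (Real.rpow_nonneg (zero_le_one.trans (le_max_right _ _)) _)
  refine ⟨K, fun s hs hss => ?_⟩
  rw [fracOrliczEnergy_eq_lintegral hG hN hφ hf, ← lintegral_const_mul' _ _ ENNReal.ofReal_ne_top]
  refine (setLIntegral_mono' (measurableSet_le measurable_const hN.continuous.measurable).compl
    fun z hz => ?_).trans (setLIntegral_le_lintegral _ _)
  rw [incrementEnergy, incrementEnergy, ← lintegral_const_mul' _ _ ENNReal.ofReal_ne_top]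
  refine lintegral_mono fun y => ?_
  rw [← ENNReal.ofReal_mul hK]
  refine ENNReal.ofReal_le_ofReal ?_
  rcases (hN.nonneg z).eq_or_lt with h0 | h0
  · rw [← h0, Real.zero_rpow hs.ne', Real.zero_rpow (hs.trans_le hss).ne']
    simp [hφ.zero]
  rw [← mul_div_assoc]
  refine div_le_div_of_nonneg_right ?_ (pow_nonneg h0.le _)
  have hzR : N z < R := not_le.1 hz
  have hs0 := Real.rpow_pos_of_pos h0 s₀
  refine (hφ.le (by positivity) ?_).trans (H _ (by positivity))
  have h1 : N z ^ (s₀ - s) ≤ max R 1 ^ s₀ :=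
    (Real.rpow_le_rpow h0.le (hzR.le.trans (le_max_left _ _)) (by linarith)).trans
      (Real.rpow_le_rpow_of_exponent_le (le_max_right _ _) (by linarith))
  rw [Real.rpow_sub h0] at h1
  calc |f (y * z) - f y| / N z ^ s
      = N z ^ s₀ / N z ^ s * (|f (y * z) - f y| / N z ^ s₀) := by field_simp
    _ ≤ _ := mul_le_mul_of_nonneg_right h1 (by positivity)

theorem incrementEnergy_add_le (hG : IsCarnotGroup d) (hN : IsHomogeneousNorm d N)
    (hφ : IsDoublingModular φ) {θ K : ℝ} (hθ : 0 ≤ θ) (hK : 0 ≤ K)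
    (H : ∀ a b, 0 ≤ a → 0 ≤ b → φ (a + b) ≤ θ * φ a + K * φ b) (hf : Measurable f) (s : ℝ)
    (z : CarnotSpace n) :
    incrementEnergy d N φ s (f + g) z ≤ ENNReal.ofReal θ * incrementEnergy d N φ s f z +
      ENNReal.ofReal K * incrementEnergy d N φ s g z := by
  have hm : Measurable fun y : CarnotSpace n =>
      ENNReal.ofReal (φ (|f (y * z) - f y| / N z ^ s) / N z ^ homDim d) :=
    (measurable_increment_kernel hG hN hφ hf s).of_uncurry_left (x := z)
      (f := fun z y => ENNReal.ofReal (φ (|f (y * z) - f y| / N z ^ s) / N z ^ homDim d))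
  unfold incrementEnergy
  rw [← lintegral_const_mul' _ _ ENNReal.ofReal_ne_top,
    ← lintegral_const_mul' _ _ ENNReal.ofReal_ne_top, ← lintegral_add_left (hm.const_mul _)]
  refine lintegral_mono fun y => hφ.ofReal_kernel_le hθ hK H (hN.nonneg z) ?_ s _
  rw [Pi.add_apply, Pi.add_apply, add_sub_add_comm]
  exact abs_add_le _ _

theorem exists_farEnergy_add_le (hG : IsCarnotGroup d) (hN : IsHomogeneousNorm d N)
    (hφ : IsDoublingModular φ) {θ : ℝ} (hθ : 1 < θ) :
    ∃ K : ℝ, 0 ≤ K ∧ ∀ f g : CarnotSpace n → ℝ, Measurable f → ∀ s R : ℝ,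
      farEnergy d N φ s R (f + g) ≤
        ENNReal.ofReal θ * farEnergy d N φ s R f + ENNReal.ofReal K * farEnergy d N φ s R g := by
  obtain ⟨K, hK, H⟩ := hφ.exists_add_le θ hθ
  refine ⟨K, hK, fun f g hf s R => ?_⟩
  have hm := (measurable_incrementEnergy hG hN hφ hf s).const_mul (ENNReal.ofReal θ)
  unfold farEnergy
  rw [← lintegral_const_mul' _ _ ENNReal.ofReal_ne_top,
    ← lintegral_const_mul' _ _ ENNReal.ofReal_ne_top, ← lintegral_add_left hm]
  exact lintegral_mono fun z =>
    incrementEnergy_add_le hG hN hφ (zero_le_one.trans hθ.le) hK H hf s z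

theorem lintegral_kernel_mul_right (hG : IsCarnotGroup d) (N : CarnotSpace n → ℝ) (φ : ℝ → ℝ)
    (f : CarnotSpace n → ℝ) (s : ℝ) (z : CarnotSpace n) :
    ∫⁻ y, ENNReal.ofReal (φ (|f (y * z)| / N z ^ s) / N z ^ homDim d) =
      ∫⁻ y, ENNReal.ofReal (φ (|f y| / N z ^ s) / N z ^ homDim d) :=
  hG.lintegral_mul_right (fun y => ENNReal.ofReal (φ (|f y| / N z ^ s) / N z ^ homDim d)) z

/-- The increment is at most `|f (y * z)| + |f y|`, and by right invariance both terms have the same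
integral in `y`. This controls the remainder of a truncation, whose support is unbounded. -/
theorem exists_farEnergy_le (hG : IsCarnotGroup d) (hN : IsHomogeneousNorm d N)
    (hφ : IsDoublingModular φ) :
    ∃ K : ℝ, 0 ≤ K ∧ ∀ f : CarnotSpace n → ℝ, Measurable f → ∀ s R : ℝ,
      farEnergy d N φ s R f ≤ ENNReal.ofReal K * tailEnergy d N φ s R f := by
  obtain ⟨K, hK, H⟩ := hφ.exists_add_le 2 one_lt_two
  refine ⟨2 + K, by positivity, fun f hf s R => ?_⟩
  unfold farEnergy tailEnergy
  rw [← lintegral_const_mul' _ _ ENNReal.ofReal_ne_top]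
  refine lintegral_mono fun z => ?_
  have hmul : Measurable fun y : CarnotSpace n => y * z :=
    hG.contDiff_mul.continuous.measurable.comp measurable_prodMk_right
  have hm : Measurable fun y : CarnotSpace n =>
      ENNReal.ofReal (φ (|f (y * z)| / N z ^ s) / N z ^ homDim d) :=
    (measurable_tail_kernel hN hφ hf s).comp ((measurable_prodMk_left (x := z)).comp hmul)
  unfold incrementEnergy
  rw [ENNReal.ofReal_add zero_le_two hK, add_mul]
  -- Only one of the two copies is translated, to match the two terms of the increment.
  nth_rewrite 1 [← lintegral_kernel_mul_right hG N φ f s z]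
  rw [← lintegral_const_mul' _ _ ENNReal.ofReal_ne_top,
    ← lintegral_const_mul' _ _ ENNReal.ofReal_ne_top,
    ← lintegral_add_left (hm.const_mul _)]
  refine lintegral_mono fun y => ?_
  exact hφ.ofReal_kernel_le zero_le_two hK H (hN.nonneg z) (abs_sub _ _) s _

/-- Far translates of a function supported in a ball have disjoint supports. -/
theorem farEnergy_eq_two_mul_tailEnergy (hG : IsCarnotGroup d) (hN : IsHomogeneousNorm d N)
    (hφ : IsDoublingModular φ) (hf : Measurable f) {M : ℝ} (hM : ∀ x, M ≤ N x → f x = 0)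
    (s : ℝ) : farEnergy d N φ s (2 * M) f = 2 * tailEnergy d N φ s (2 * M) f := by
  unfold farEnergy tailEnergy
  rw [← lintegral_const_mul' _ _ ENNReal.ofNat_ne_top]
  refine setLIntegral_congr_fun (measurableSet_le measurable_const hN.continuous.measurable)
    fun z hz => ?_
  have hmul : Measurable fun y : CarnotSpace n => y * z :=
    hG.contDiff_mul.continuous.measurable.comp measurable_prodMk_right
  have hm : Measurable fun y : CarnotSpace n =>
      ENNReal.ofReal (φ (|f (y * z)| / N z ^ s) / N z ^ homDim d) :=
    (measurable_tail_kernel hN hφ hf s).comp ((measurable_prodMk_left (x := z)).comp hmul)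
  unfold incrementEnergy
  rw [two_mul]
  nth_rewrite 1 [← lintegral_kernel_mul_right hG N φ f s z]
  rw [← lintegral_add_left hm]
  refine lintegral_congr fun y => ?_
  have hz' : 2 * M ≤ N z := hz
  -- Since `z = y⁻¹ * (y * z)`, this says `N z ≤ N (y * z) + N y`: with `N z ≥ 2 * M`, one of the
  -- two norms is at least `M`.
  have h1 := hN.le_add (y * z) y
  rw [inv_mul_cancel_left] at h1
  rcases le_total M (N y) with h | h
  · simp [hM y h, hφ.zero]
  · simp [hM (y * z) (by linarith), hφ.zero]

/-- Tonelli and polar coordinates: the Jacobian `Q r ^ (Q - 1)` against `r ^ Q` leaves `Q / r`. -/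
theorem tailEnergy_eq (hG : IsCarnotGroup d) (hN : IsHomogeneousNorm d N)
    (hφ : IsDoublingModular φ) (hf : Measurable f) (s : ℝ) {R : ℝ} (hR : 0 < R) :
    tailEnergy d N φ s R f = homDim d * unitBallVolume N *
      ∫⁻ y, ∫⁻ r in Ici R, ENNReal.ofReal (φ (|f y| / r ^ s) / r) := by
  have hfin : (homDim d * unitBallVolume N : ℝ≥0∞) ≠ ⊤ :=
    ENNReal.mul_ne_top (ENNReal.natCast_ne_top _) (hN.unitBallVolume_ne_top hG)
  unfold tailEnergy
  rw [lintegral_lintegral_swap (measurable_tail_kernel hN hφ hf s).aemeasurable,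
    ← lintegral_const_mul' _ _ hfin]
  refine lintegral_congr fun y => ?_
  have hmeas : Measurable fun r : ℝ =>
      ENNReal.ofReal (φ (|f y| / max r 0 ^ s) / max r 0 ^ homDim d) :=
    hφ.measurable_kernel measurable_const (by fun_prop) (fun _ => le_max_right _ _) s _
  have h1 := hN.setLIntegral_comp hG hR hmeas
  simp only [max_eq_left (hN.nonneg _)] at h1
  rw [h1, mul_comm (homDim d : ℝ≥0∞), mul_assoc,
    ← lintegral_const_mul' _ _ (ENNReal.natCast_ne_top _)]
  congr 1
  refine setLIntegral_congr_fun measurableSet_Ici fun r hr => ?_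
  have hr0 : 0 < r := hR.trans_le hr
  rw [max_eq_left hr0.le, ← ENNReal.ofReal_natCast, ← ENNReal.ofReal_mul (by positivity),
    ← ENNReal.ofReal_mul (by positivity)]
  congr 1
  have hQ : r ^ homDim d = r ^ (homDim d - 1) * r := by
    rw [← pow_succ, Nat.sub_add_cancel hG.homDim_pos]
  rw [hQ]
  field_simp

end Energies

/-! ### Two-sided bounds for the tail energy. -/

section TailBounds

variable {n : ℕ} [Group (CarnotSpace n)] {d : Fin n → ℕ} {N : CarnotSpace n → ℝ} {ϕ : ℝ → ℝ}
  {f : CarnotSpace n → ℝ}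

theorem le_mul_tailEnergy (hG : IsCarnotGroup d) (hN : IsHomogeneousNorm d N)
    (hϕ : IsOrliczDensity ϕ) {p : ℝ} (hp0 : 0 < p)
    (hp : ∀ t, 0 < t → t * ϕ t ≤ p * orlicz ϕ t) (hf : Measurable f) {s R : ℝ} (hs : 0 < s)
    (hR : 0 < R) :
    homDim d * unitBallVolume N / ENNReal.ofReal p *
        ∫⁻ y, ENNReal.ofReal (orlicz ϕ (|f y| / R ^ s)) ≤
      ENNReal.ofReal s * tailEnergy d N (orlicz ϕ) s R f := by
  rw [tailEnergy_eq hG hN (hϕ.isDoublingModular_orlicz hp0 hp) hf s hR]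
  have h : ∫⁻ y, ENNReal.ofReal (orlicz ϕ (|f y| / R ^ s)) ≤ ENNReal.ofReal p *
      (ENNReal.ofReal s *
        ∫⁻ y, ∫⁻ r in Ici R, ENNReal.ofReal (orlicz ϕ (|f y| / r ^ s) / r)) := by
    rw [← lintegral_const_mul' _ _ ENNReal.ofReal_ne_top,
      ← lintegral_const_mul' _ _ ENNReal.ofReal_ne_top]
    exact lintegral_mono fun y => hϕ.radial_lower hp0 hp (abs_nonneg _) hR hs
  refine (mul_le_mul' le_rfl h).trans_eq ?_
  rw [← mul_assoc (_ / _) (ENNReal.ofReal p),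
    ENNReal.div_mul_cancel (by simpa using hp0) ENNReal.ofReal_ne_top]
  ring

theorem mul_tailEnergy_le (hG : IsCarnotGroup d) (hN : IsHomogeneousNorm d N)
    (hϕ : IsOrliczDensity ϕ) (hφ : IsDoublingModular (orlicz ϕ)) {p : ℝ} (hp0 : 0 < p)
    (hp : ∀ t, 0 < t → p * orlicz ϕ t ≤ t * ϕ t) (hf : Measurable f) {s R : ℝ} (hs : 0 < s)
    (hR : 1 ≤ R) :
    ENNReal.ofReal s * tailEnergy d N (orlicz ϕ) s R f ≤
      homDim d * unitBallVolume N / ENNReal.ofReal p * orliczEnergy (orlicz ϕ) f := by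
  have hR0 : 0 < R := zero_lt_one.trans_le hR
  rw [tailEnergy_eq hG hN hφ hf s hR0]
  have h : ENNReal.ofReal p * (ENNReal.ofReal s *
      ∫⁻ y, ∫⁻ r in Ici R, ENNReal.ofReal (orlicz ϕ (|f y| / r ^ s) / r)) ≤
      orliczEnergy (orlicz ϕ) f := by
    rw [← lintegral_const_mul' _ _ ENNReal.ofReal_ne_top,
      ← lintegral_const_mul' _ _ ENNReal.ofReal_ne_top]
    -- As `R ≥ 1`, the divisor `R ^ s` is at least `1` and can be dropped.
    refine lintegral_mono fun y => (hϕ.radial_upper hp0 hp (abs_nonneg _) hR0 hs).trans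
      (ENNReal.ofReal_le_ofReal (hφ.le ?_ (div_le_self (abs_nonneg _) ?_)))
    · exact div_nonneg (abs_nonneg _) (Real.rpow_nonneg hR0.le s)
    · exact Real.one_le_rpow hR hs.le
  refine le_trans (le_of_eq ?_) (mul_le_mul' le_rfl h)
  rw [← mul_assoc (_ / _) (ENNReal.ofReal p),
    ENNReal.div_mul_cancel (by simpa using hp0) ENNReal.ofReal_ne_top]
  ring

end TailBounds

/-! ### Passing to the limit: auxiliary facts and truncation. -/

/-- Let `θ` decrease to `1`. The exponent counts the losses of a factor `θ`: one in the upper bound,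
two in the lower bound. -/
theorem ENNReal.le_of_forall_one_lt_le_ofReal_mul {x y : ℝ≥0∞} {k : ℕ}
    (h : ∀ θ : ℝ, 1 < θ → x ≤ ENNReal.ofReal θ ^ k * y) : x ≤ y := by
  have h1 : Tendsto (fun θ : ℝ => ENNReal.ofReal θ ^ k * y) (𝓝[>] 1) (𝓝 (1 * y)) := by
    refine ENNReal.Tendsto.mul_const ?_ (Or.inl one_ne_zero)
    have h2 : Tendsto (fun θ : ℝ => ENNReal.ofReal θ ^ k) (𝓝[>] 1)
        (𝓝 (ENNReal.ofReal 1 ^ k)) :=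
      (((ENNReal.continuous_pow k).comp ENNReal.continuous_ofReal).tendsto 1).mono_left
        nhdsWithin_le_nhds
    simpa using h2
  rw [one_mul] at h1
  exact ge_of_tendsto h1 (eventually_mem_nhdsWithin.mono h)

theorem ENNReal.le_mul_liminf_add {α : Type*} {l : Filter α} {A a b : ℝ≥0∞} {h : α → ℝ≥0∞}
    (ha0 : a ≠ 0) (ha : a ≠ ⊤) (H : ∀ᶠ x in l, A ≤ a * h x + b) :
    A ≤ a * liminf h l + b := by
  have h1 : (A - b) / a ≤ liminf h l := by
    refine le_liminf_of_le (by isBoundedDefault) (H.mono fun x hx => ?_)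
    exact ENNReal.div_le_of_le_mul (by rw [mul_comm]; exact tsub_le_iff_right.2 hx)
  rw [ENNReal.div_le_iff ha0 ha, mul_comm] at h1
  exact tsub_le_iff_right.1 h1

section Truncation

variable {n : ℕ} {N : CarnotSpace n → ℝ} {φ : ℝ → ℝ} {u : CarnotSpace n → ℝ}

theorem orliczEnergy_indicator (hφ : φ 0 = 0) (u : CarnotSpace n → ℝ) {S : Set (CarnotSpace n)}
    (hS : MeasurableSet S) :
    orliczEnergy φ (S.indicator u) = ∫⁻ x in S, ENNReal.ofReal (φ |u x|) := by
  rw [orliczEnergy, ← lintegral_indicator hS]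
  refine lintegral_congr fun x => ?_
  by_cases hx : x ∈ S <;> simp [hx, hφ]

theorem orliczEnergy_indicator_add_compl (hφ : φ 0 = 0) (u : CarnotSpace n → ℝ)
    {S : Set (CarnotSpace n)} (hS : MeasurableSet S) :
    orliczEnergy φ (S.indicator u) + orliczEnergy φ (Sᶜ.indicator u) = orliczEnergy φ u := by
  rw [orliczEnergy_indicator hφ u hS, orliczEnergy_indicator hφ u hS.compl,
    lintegral_add_compl _ hS, orliczEnergy]

/-- Continuity from above of the finite measure with density `φ(|u|)`, along sets decreasing to the
empty set. -/
theorem tendsto_orliczEnergy_indicator_compl (hφ : φ 0 = 0) (hN : Measurable N)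
    (hu : orliczEnergy φ u ≠ ⊤) :
    Tendsto (fun M : ℕ => orliczEnergy φ ({x | N x < M}ᶜ.indicator u)) atTop (𝓝 0) := by
  have hS (M : ℕ) : MeasurableSet {x : CarnotSpace n | N x < M} :=
    measurableSet_lt hN measurable_const
  set μ := (volume : Measure (CarnotSpace n)).withDensity fun x => ENNReal.ofReal (φ |u x|)
  have h1 (M : ℕ) : orliczEnergy φ ({x | N x < M}ᶜ.indicator u) = μ {x | N x < M}ᶜ := by
    rw [orliczEnergy_indicator hφ u (hS M).compl, withDensity_apply _ (hS M).compl]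
  have h2 : ⋂ M : ℕ, {x : CarnotSpace n | N x < M}ᶜ = ∅ := by
    refine eq_empty_iff_forall_notMem.2 fun x hx => ?_
    obtain ⟨M, hM⟩ := exists_nat_gt (N x)
    exact mem_iInter.1 hx M hM
  have hfin : μ univ ≠ ⊤ := by
    rwa [withDensity_apply _ MeasurableSet.univ, setLIntegral_univ]
  have h3 := tendsto_measure_iInter_atTop (μ := μ)
    (s := fun M : ℕ => {x : CarnotSpace n | N x < M}ᶜ)
    (fun M => (hS M).compl.nullMeasurableSet)
    (fun M M' hMM x (hx : ¬ N x < M') => show ¬ N x < M from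
      fun h => hx (h.trans_le (by exact_mod_cast hMM)))
    ⟨0, ne_top_of_le_ne_top hfin (measure_mono (subset_univ _))⟩
  rw [h2, measure_empty] at h3
  simpa only [h1, Function.comp_def] using h3

theorem orliczEnergy_congr_ae {v : CarnotSpace n → ℝ} (h : u =ᵐ[volume] v) :
    orliczEnergy φ u = orliczEnergy φ v :=
  lintegral_congr_ae (h.mono fun x hx => by simp only [hx])

end Truncation

/-! ### The upper and lower limits. -/

section Limits

variable {n : ℕ} [Group (CarnotSpace n)] {d : Fin n → ℕ} {N : CarnotSpace n → ℝ} {ϕ : ℝ → ℝ}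
  {u : CarnotSpace n → ℝ} {p q : ℝ}

theorem limsup_mul_fracOrliczEnergy_le (hG : IsCarnotGroup d) (hN : IsHomogeneousNorm d N)
    (hϕ : IsOrliczDensity ϕ) (hp0 : 0 < p) (hp : ∀ t, 0 < t → p * orlicz ϕ t ≤ t * ϕ t)
    (hφ : IsDoublingModular (orlicz ϕ)) (hu : Measurable u)
    (hΦ : orliczEnergy (orlicz ϕ) u ≠ ⊤) {s₀ : ℝ} (hs₀ : 0 < s₀)
    (hF : fracOrliczEnergy d N (orlicz ϕ) s₀ u ≠ ⊤) :
    limsup (fun s : ℝ => ENNReal.ofReal s * fracOrliczEnergy d N (orlicz ϕ) s u) (𝓝[>] 0) ≤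
      2 * (homDim d * unitBallVolume N / ENNReal.ofReal p) * orliczEnergy (orlicz ϕ) u := by
  have hc : (homDim d * unitBallVolume N / ENNReal.ofReal p : ℝ≥0∞) ≠ ⊤ :=
    ENNReal.div_ne_top (ENNReal.mul_ne_top (ENNReal.natCast_ne_top _)
      (hN.unitBallVolume_ne_top hG)) (by simpa using hp0)
  have hbound {f : CarnotSpace n → ℝ} (hf : Measurable f) {s R : ℝ} (hs : 0 < s) (hR : 1 ≤ R) :=
    mul_tailEnergy_le hG hN hϕ hφ hp0 hp hf hs hR
  set c : ℝ≥0∞ := homDim d * unitBallVolume N / ENNReal.ofReal p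
  refine ENNReal.le_of_forall_one_lt_le_ofReal_mul (k := 1) fun θ hθ => ?_
  rw [pow_one]
  obtain ⟨K₁, -, H₁⟩ := exists_farEnergy_add_le hG hN hφ hθ
  obtain ⟨K₂, -, H₂⟩ := exists_farEnergy_le hG hN hφ
  have hlim := tendsto_orliczEnergy_indicator_compl hφ.zero hN.continuous.measurable hΦ
  have hlim' : Tendsto (fun M : ℕ => ENNReal.ofReal θ * (2 * c * orliczEnergy (orlicz ϕ) u) +
      ENNReal.ofReal K₁ * ENNReal.ofReal K₂ * c *
        orliczEnergy (orlicz ϕ) ({x | N x < M}ᶜ.indicator u)) atTop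
      (𝓝 (ENNReal.ofReal θ * (2 * c * orliczEnergy (orlicz ϕ) u) +
        ENNReal.ofReal K₁ * ENNReal.ofReal K₂ * c * 0)) := by
    refine tendsto_const_nhds.add (ENNReal.Tendsto.const_mul hlim (Or.inr ?_))
    finiteness
  rw [mul_zero, add_zero] at hlim'
  -- From here `M` is fixed and only `s` tends to `0`.
  refine ge_of_tendsto hlim' ((eventually_ge_atTop 1).mono fun M hM => ?_)
  have hS : MeasurableSet {x : CarnotSpace n | N x < M} :=
    measurableSet_lt hN.continuous.measurable measurable_const
  have hsum := orliczEnergy_indicator_add_compl hφ.zero u hS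
  have hv : Measurable ({x | N x < M}.indicator u) := hu.indicator hS
  have hw : Measurable ({x | N x < M}ᶜ.indicator u) := hu.indicator hS.compl
  have hvw : {x | N x < M}.indicator u + {x | N x < M}ᶜ.indicator u = u :=
    indicator_self_add_compl _ u
  have hvM : ∀ x, (M : ℝ) ≤ N x → {x | N x < M}.indicator u x = 0 := fun x hx =>
    indicator_of_notMem (s := {x | N x < M}) (fun h => absurd hx (not_le_of_gt h)) u
  set v := {x | N x < M}.indicator u
  set w := {x | N x < M}ᶜ.indicator u
  have hM1 : (1 : ℝ) ≤ M := by exact_mod_cast hM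
  have hR : (1 : ℝ) ≤ 2 * M := by linarith
  -- `K₃` depends on `M`, harmlessly: its term carries the factor `s` and vanishes before `M` moves.
  obtain ⟨K₃, H₃⟩ := exists_near_le hG hN hφ hu (s₀ := s₀) (2 * M)
  have hev : ∀ᶠ s : ℝ in 𝓝[>] 0, ENNReal.ofReal s * fracOrliczEnergy d N (orlicz ϕ) s u ≤
      ENNReal.ofReal s * (ENNReal.ofReal K₃ * fracOrliczEnergy d N (orlicz ϕ) s₀ u) +
      (ENNReal.ofReal θ * (2 * c * orliczEnergy (orlicz ϕ) u) +
        ENNReal.ofReal K₁ * ENNReal.ofReal K₂ * c * orliczEnergy (orlicz ϕ) w) := by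
    filter_upwards [Ioc_mem_nhdsGT hs₀] with s hs
    have hfar := H₁ v w hv s (2 * M)
    rw [hvw, farEnergy_eq_two_mul_tailEnergy hG hN hφ hv hvM] at hfar
    have hv' := (hbound hv hs.1 hR).trans (mul_le_mul' le_rfl (hsum ▸ le_self_add))
    have hw' := hbound hw hs.1 hR
    rw [fracOrliczEnergy_eq_add hG hN hφ hu s (2 * M), mul_add]
    refine add_le_add (mul_le_mul' le_rfl (H₃ s hs.1 hs.2)) ?_
    calc ENNReal.ofReal s * farEnergy d N (orlicz ϕ) s (2 * M) u
        ≤ ENNReal.ofReal s * (ENNReal.ofReal θ * (2 * tailEnergy d N (orlicz ϕ) s (2 * M) v) +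
          ENNReal.ofReal K₁ * (ENNReal.ofReal K₂ * tailEnergy d N (orlicz ϕ) s (2 * M) w)) :=
          mul_le_mul' le_rfl (hfar.trans
            (add_le_add le_rfl (mul_le_mul' le_rfl (H₂ w hw s (2 * M)))))
      _ = ENNReal.ofReal θ * (2 * (ENNReal.ofReal s * tailEnergy d N (orlicz ϕ) s (2 * M) v)) +
          ENNReal.ofReal K₁ * ENNReal.ofReal K₂ *
            (ENNReal.ofReal s * tailEnergy d N (orlicz ϕ) s (2 * M) w) := by ring
      _ ≤ ENNReal.ofReal θ * (2 * (c * orliczEnergy (orlicz ϕ) u)) +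
          ENNReal.ofReal K₁ * ENNReal.ofReal K₂ * (c * orliczEnergy (orlicz ϕ) w) := by gcongr
      _ = _ := by ring
  have hzero : Tendsto (fun s : ℝ => ENNReal.ofReal s *
      (ENNReal.ofReal K₃ * fracOrliczEnergy d N (orlicz ϕ) s₀ u)) (𝓝[>] 0) (𝓝 0) := by
    have h1 : Tendsto ENNReal.ofReal (𝓝[>] 0) (𝓝 (ENNReal.ofReal 0)) :=
      (ENNReal.continuous_ofReal.tendsto 0).mono_left nhdsWithin_le_nhds
    have h2 := ENNReal.Tendsto.mul_const h1
      (b := ENNReal.ofReal K₃ * fracOrliczEnergy d N (orlicz ϕ) s₀ u) (Or.inr (by finiteness))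
    simpa using h2
  have h := (hzero.add_const (ENNReal.ofReal θ * (2 * c * orliczEnergy (orlicz ϕ) u) +
    ENNReal.ofReal K₁ * ENNReal.ofReal K₂ * c * orliczEnergy (orlicz ϕ) w)).limsup_eq
  rw [zero_add] at h
  exact (limsup_le_limsup hev).trans_eq h

/-- Here the quasi-subadditivity is applied to `v = u + (-w)`, so that the far energy of the
truncation `v`, known from below, is bounded by that of `u` up to a remainder. -/
theorem le_liminf_mul_fracOrliczEnergy (hG : IsCarnotGroup d) (hN : IsHomogeneousNorm d N)
    (hϕ : IsOrliczDensity ϕ) (hp0 : 0 < p) (hp : ∀ t, 0 < t → p * orlicz ϕ t ≤ t * ϕ t)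
    (hq0 : 0 < q) (hq : ∀ t, 0 < t → t * ϕ t ≤ q * orlicz ϕ t) (hu : Measurable u)
    (hΦ : orliczEnergy (orlicz ϕ) u ≠ ⊤) :
    2 * (homDim d * unitBallVolume N / ENNReal.ofReal q) * orliczEnergy (orlicz ϕ) u ≤
      liminf (fun s : ℝ => ENNReal.ofReal s * fracOrliczEnergy d N (orlicz ϕ) s u)
        (𝓝[>] 0) := by
  have hφ := hϕ.isDoublingModular_orlicz hq0 hq
  have hfin : (homDim d * unitBallVolume N : ℝ≥0∞) ≠ ⊤ :=
    ENNReal.mul_ne_top (ENNReal.natCast_ne_top _) (hN.unitBallVolume_ne_top hG)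
  have hcp : (homDim d * unitBallVolume N / ENNReal.ofReal p : ℝ≥0∞) ≠ ⊤ :=
    ENNReal.div_ne_top hfin (by simpa using hp0)
  have hcq : (homDim d * unitBallVolume N / ENNReal.ofReal q : ℝ≥0∞) ≠ ⊤ :=
    ENNReal.div_ne_top hfin (by simpa using hq0)
  have hupper {f : CarnotSpace n → ℝ} (hf : Measurable f) {s R : ℝ} (hs : 0 < s) (hR : 1 ≤ R) :=
    mul_tailEnergy_le hG hN hϕ hφ hp0 hp hf hs hR
  have hlower {f : CarnotSpace n → ℝ} (hf : Measurable f) {s R : ℝ} (hs : 0 < s) (hR : 0 < R) :=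
    le_mul_tailEnergy hG hN hϕ hq0 hq hf hs hR
  set cp : ℝ≥0∞ := homDim d * unitBallVolume N / ENNReal.ofReal p
  set cq : ℝ≥0∞ := homDim d * unitBallVolume N / ENNReal.ofReal q
  refine ENNReal.le_of_forall_one_lt_le_ofReal_mul (k := 2) fun θ hθ => ?_
  obtain ⟨η, hη, Hη⟩ := hφ.exists_dilate_le θ hθ
  obtain ⟨K₁, -, H₁⟩ := exists_farEnergy_add_le hG hN hφ hθ
  obtain ⟨K₂, -, H₂⟩ := exists_farEnergy_le hG hN hφ
  have hlim := tendsto_orliczEnergy_indicator_compl hφ.zero hN.continuous.measurable hΦ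
  -- The first term pays for the far energy of `w`; `2 * cq` pays for replacing the Orlicz energy of
  -- `v` by that of `u`.
  set B := ENNReal.ofReal θ * (ENNReal.ofReal K₁ * ENNReal.ofReal K₂ * cp) + 2 * cq with hB
  set F := liminf (fun s : ℝ => ENNReal.ofReal s * fracOrliczEnergy d N (orlicz ϕ) s u) (𝓝[>] 0)
  have hlim' : Tendsto (fun M : ℕ => ENNReal.ofReal θ ^ 2 * F +
      B * orliczEnergy (orlicz ϕ) ({x | N x < M}ᶜ.indicator u)) atTop
      (𝓝 (ENNReal.ofReal θ ^ 2 * F + B * 0)) := by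
    refine tendsto_const_nhds.add (ENNReal.Tendsto.const_mul hlim (Or.inr ?_))
    finiteness
  rw [mul_zero, add_zero] at hlim'
  refine ge_of_tendsto hlim' ((eventually_ge_atTop 1).mono fun M hM => ?_)
  have hS : MeasurableSet {x : CarnotSpace n | N x < M} :=
    measurableSet_lt hN.continuous.measurable measurable_const
  have hsum := orliczEnergy_indicator_add_compl hφ.zero u hS
  have hv : Measurable ({x | N x < M}.indicator u) := hu.indicator hS
  have hw : Measurable ({x | N x < M}ᶜ.indicator u) := hu.indicator hS.compl
  have hvw : u + -{x | N x < M}ᶜ.indicator u = {x | N x < M}.indicator u := by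
    rw [← sub_eq_add_neg, sub_eq_iff_eq_add]
    exact (indicator_self_add_compl _ u).symm
  have hvM : ∀ x, (M : ℝ) ≤ N x → {x | N x < M}.indicator u x = 0 := fun x hx =>
    indicator_of_notMem (s := {x | N x < M}) (fun h => absurd hx (not_le_of_gt h)) u
  set v := {x | N x < M}.indicator u
  set w := {x | N x < M}ᶜ.indicator u
  have hM1 : (1 : ℝ) ≤ M := by exact_mod_cast hM
  have hR : (1 : ℝ) ≤ 2 * M := by linarith
  have hθ0 : ENNReal.ofReal θ ≠ 0 := by simpa using zero_lt_one.trans hθ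
  refine ENNReal.le_mul_liminf_add (pow_ne_zero 2 hθ0) (by finiteness) ?_
  have hpow : ∀ᶠ s : ℝ in 𝓝[>] 0, (2 * M : ℝ) ^ s ≤ 1 + η := by
    have h1 : Tendsto (fun s : ℝ => (2 * M : ℝ) ^ s) (𝓝[>] 0) (𝓝 ((2 * M : ℝ) ^ (0 : ℝ))) :=
      ((Real.continuous_const_rpow (by linarith)).tendsto 0).mono_left nhdsWithin_le_nhds
    rw [Real.rpow_zero] at h1
    exact h1.eventually (Iic_mem_nhds (by linarith))
  filter_upwards [hpow, self_mem_nhdsWithin] with s hsη (hs : 0 < s)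
  have hnegw : orliczEnergy (orlicz ϕ) (-w) = orliczEnergy (orlicz ϕ) w := by
    simp [orliczEnergy]
  have hfar := H₁ u (-w) hu s (2 * M)
  rw [hvw, farEnergy_eq_two_mul_tailEnergy hG hN hφ hv hvM] at hfar
  have hw' := hupper hw.neg hs hR
  rw [hnegw] at hw'
  have hRs : 0 < (2 * M : ℝ) ^ s := Real.rpow_pos_of_pos (by linarith) s
  -- The second loss of `θ`: once `(2 * M) ^ s ≤ 1 + η`, removing this divisor is a small dilation.
  have hdil : orliczEnergy (orlicz ϕ) v ≤ ENNReal.ofReal θ *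
      ∫⁻ y, ENNReal.ofReal (orlicz ϕ (|v y| / (2 * M) ^ s)) := by
    rw [← lintegral_const_mul' _ _ ENNReal.ofReal_ne_top]
    refine lintegral_mono fun y => ?_
    rw [← ENNReal.ofReal_mul (by linarith)]
    refine ENNReal.ofReal_le_ofReal
      ((hφ.le (abs_nonneg _) ?_).trans (Hη _ (div_nonneg (abs_nonneg _) hRs.le)))
    rw [← mul_div_assoc, le_div_iff₀ hRs, mul_comm]
    exact mul_le_mul_of_nonneg_right hsη (abs_nonneg _)
  have hv' : 2 * cq * orliczEnergy (orlicz ϕ) v ≤ ENNReal.ofReal θ ^ 2 *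
      (ENNReal.ofReal s * fracOrliczEnergy d N (orlicz ϕ) s u) +
      ENNReal.ofReal θ * (ENNReal.ofReal K₁ * ENNReal.ofReal K₂ * cp) *
        orliczEnergy (orlicz ϕ) w := by
    calc 2 * cq * orliczEnergy (orlicz ϕ) v
        ≤ 2 * cq * (ENNReal.ofReal θ *
            ∫⁻ y, ENNReal.ofReal (orlicz ϕ (|v y| / (2 * M) ^ s))) := mul_le_mul' le_rfl hdil
      _ = ENNReal.ofReal θ * (2 * (cq *
            ∫⁻ y, ENNReal.ofReal (orlicz ϕ (|v y| / (2 * M) ^ s)))) := by ring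
      _ ≤ ENNReal.ofReal θ * (2 * (ENNReal.ofReal s * tailEnergy d N (orlicz ϕ) s (2 * M) v)) :=
          mul_le_mul' le_rfl (mul_le_mul' le_rfl (hlower hv hs (by linarith)))
      _ = ENNReal.ofReal θ * (ENNReal.ofReal s * (2 * tailEnergy d N (orlicz ϕ) s (2 * M) v)) := by
          ring
      _ ≤ ENNReal.ofReal θ * (ENNReal.ofReal s *
            (ENNReal.ofReal θ * fracOrliczEnergy d N (orlicz ϕ) s u + ENNReal.ofReal K₁ *
              (ENNReal.ofReal K₂ * tailEnergy d N (orlicz ϕ) s (2 * M) (-w)))) :=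
          mul_le_mul' le_rfl (mul_le_mul' le_rfl (hfar.trans (add_le_add
            (mul_le_mul' le_rfl (farEnergy_le_fracOrliczEnergy hG hN hφ hu s _))
            (mul_le_mul' le_rfl (H₂ (-w) hw.neg s (2 * M))))))
      _ = ENNReal.ofReal θ ^ 2 * (ENNReal.ofReal s * fracOrliczEnergy d N (orlicz ϕ) s u) +
            ENNReal.ofReal θ * (ENNReal.ofReal K₁ * ENNReal.ofReal K₂) *
              (ENNReal.ofReal s * tailEnergy d N (orlicz ϕ) s (2 * M) (-w)) := by ring
      _ ≤ ENNReal.ofReal θ ^ 2 * (ENNReal.ofReal s * fracOrliczEnergy d N (orlicz ϕ) s u) +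
            ENNReal.ofReal θ * (ENNReal.ofReal K₁ * ENNReal.ofReal K₂) *
              (cp * orliczEnergy (orlicz ϕ) w) :=
          add_le_add le_rfl (mul_le_mul' le_rfl hw')
      _ = _ := by ring
  rw [← hsum, mul_add, hB, add_mul, ← add_assoc]
  exact add_le_add hv' le_rfl

theorem fracOrliczEnergy_congr_ae {φ : ℝ → ℝ} {v : CarnotSpace n → ℝ} (h : u =ᵐ[volume] v)
    (s : ℝ) : fracOrliczEnergy d N φ s u = fracOrliczEnergy d N φ s v := by
  refine lintegral_congr_ae ?_
  filter_upwards [Measure.quasiMeasurePreserving_fst.ae h,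
    Measure.quasiMeasurePreserving_snd.ae h] with x h1 h2
  rw [h1, h2]

end Limits

theorem theorem1p3 {n : ℕ} [Group (CarnotSpace n)] (d : Fin n → ℕ) (hG : IsCarnotGroup d)
    (N : CarnotSpace n → ℝ) (hN : IsHomogeneousNorm d N)
    (ϕ : ℝ → ℝ) (hϕ : IsOrliczDensity ϕ)
    (pminus pplus : ℝ) (hp : 1 < pminus)
    (hgrowth : ∀ t : ℝ, 0 < t →
      pminus ≤ t * ϕ t / orlicz ϕ t ∧ t * ϕ t / orlicz ϕ t ≤ pplus)
    (hM : MinkowskiType n (orlicz ϕ))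
    (s₀ : ℝ) (hs₀ : 0 < s₀) (hs₁ : s₀ < 1)
    (u : CarnotSpace n → ℝ) (hu : u ∈ FracOrliczSobolev d N (orlicz ϕ) s₀) :
    (2 * (homDim d * unitBallVolume N / ENNReal.ofReal pplus) * orliczEnergy (orlicz ϕ) u ≤
        liminf (fun s : ℝ => ENNReal.ofReal s * fracOrliczEnergy d N (orlicz ϕ) s u) (𝓝[>] 0) ∧
      liminf (fun s : ℝ => ENNReal.ofReal s * fracOrliczEnergy d N (orlicz ϕ) s u) (𝓝[>] 0) ≤
        limsup (fun s : ℝ => ENNReal.ofReal s * fracOrliczEnergy d N (orlicz ϕ) s u) (𝓝[>] 0) ∧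
      limsup (fun s : ℝ => ENNReal.ofReal s * fracOrliczEnergy d N (orlicz ϕ) s u) (𝓝[>] 0) ≤
        2 * (homDim d * unitBallVolume N / ENNReal.ofReal pminus) * orliczEnergy (orlicz ϕ) u) ∧
    ∀ L : ℝ≥0∞,
      Tendsto (fun s : ℝ => ENNReal.ofReal s * fracOrliczEnergy d N (orlicz ϕ) s u)
          (𝓝[>] 0) (𝓝 L) →
        2 * (homDim d * unitBallVolume N / ENNReal.ofReal pplus) * orliczEnergy (orlicz ϕ) u ≤ L ∧
        L ≤ 2 * (homDim d * unitBallVolume N / ENNReal.ofReal pminus) *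
          orliczEnergy (orlicz ϕ) u := by
  have hp0 : 0 < pminus := zero_lt_one.trans hp
  have hq0 : 0 < pplus := hp0.trans_le ((hgrowth 1 one_pos).1.trans (hgrowth 1 one_pos).2)
  have hpos : ∀ t, 0 < t → 0 < orlicz ϕ t := by
    intro t ht
    -- A nonpositive denominator, zero included, would make the quotient nonpositive, against
    -- `pminus > 1`.
    by_contra! h
    have h1 : t * ϕ t / orlicz ϕ t ≤ 0 :=
      div_nonpos_of_nonneg_of_nonpos (mul_pos ht (hϕ.pos t ht)).le h
    linarith [(hgrowth t ht).1]
  have hlo : ∀ t, 0 < t → pminus * orlicz ϕ t ≤ t * ϕ t := fun t ht =>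
    (le_div_iff₀ (hpos t ht)).1 (hgrowth t ht).1
  have hhi : ∀ t, 0 < t → t * ϕ t ≤ pplus * orlicz ϕ t := fun t ht =>
    (div_le_iff₀ (hpos t ht)).1 (hgrowth t ht).2
  obtain ⟨⟨hum, hΦ⟩, hF⟩ := hu
  -- Both energies depend only on the almost-everywhere class, so `u` may be replaced by a
  -- measurable representative.
  have hae := hum.ae_eq_mk
  simp only [orliczEnergy_congr_ae hae, fracOrliczEnergy_congr_ae (d := d) (N := N) hae] at hΦ hF ⊢
  have hlower := le_liminf_mul_fracOrliczEnergy hG hN hϕ hp0 hlo hq0 hhi hum.measurable_mk hΦ.ne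
  have hupper := limsup_mul_fracOrliczEnergy_le hG hN hϕ hp0 hlo
    (hϕ.isDoublingModular_orlicz hq0 hhi) hum.measurable_mk hΦ.ne hs₀ hF.ne
  refine ⟨⟨hlower, liminf_le_limsup, hupper⟩, fun L hL => ?_⟩
  rw [hL.liminf_eq] at hlower
  rw [hL.limsup_eq] at hupper
  exact ⟨hlower, hupper⟩
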